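/- Let $q,a,u,v,w$ be nonzero complex numbers with $|q|<1$ and $|q|<|a w^{\pm1}|<1$. Write $(z;q)_\infty=\prod_{j\ge 0}(1-zq^j)$, $(z;q)_n=\prod_{j=0}^{n-1}(1-zq^j)$, $(z_1,\dots,z_m;q)_\infty=\prod_i (z_i;q)_\infty$, and $${}_2\phi_1(A,B;C;q,Z)=\sum_{n\ge 0}\frac{(A;q)_n(B;q)_n}{(q;q)_n(C;q)_n}Z^n .$$ A sign $\pm$ in an argument of $(\,\cdot\,;q)_\infty$ means the product over all choices of signs (independent for different $\pm$). Put $$E(v)=\frac{(qv^2,\,au/v,\,a/(uv);q)_\infty}{(1/v^2,\,qv/(au),\,quv/a;q)_\infty}\prod_{\epsilon=\pm1}{}_2\phi_1\!\left(\frac{quv}{a},\frac{qv}{au};qv^2;q,aw^{\epsilon}\right),$$ $$M(v)=\frac{(qv^2,\,qu/(av),\,q/(auv);q)_\infty}{(1/v^2,\,av/u,\,auv;q)_\infty}\prod_{\epsilon=\pm1}{}_2\phi_1\!\left(auv,\frac{av}{u};qv^2;q,\frac{qw^{\epsilon}}{a}\right),$$ $$P=\frac{(qw^{\pm1}/a;q)_\infty}{(aw^{\pm1};q)_\infty}\,\frac{(au^{\pm1}v^{\pm1};q)_\infty}{(qu^{\pm1}v^{\pm1}/a;q)_\infty}.$$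 (1) If $v^2\notin q^{\mathbb Z}$ and none of the four numbers $au^{\pm1}v^{\pm1}$ lies in $q^{\mathbb Z}$, then $$E(v)+E(1/v)=P\,\bigl(M(v)+M(1/v)\bigr).$$ (2) Assume in addition to the standing assumptions (but not those of (1)) that $|q|<|au^{\pm2}|<1$ and $|q|<|av^{\pm2}|<1$, and fix any square roots $q^{1/2}$, $a^{1/2}$. Define the electric index and the mirror index of the $U(1)$, $N_f=2$ theory by $$I_e=\sum_{k\in\mathbb Z}a^{|k|}w^k\int_{\mathbb T}\frac{(a^{1/2}q^{1/2+|k|/2}u^{\pm1}z^{-1},\,a^{1/2}q^{1/2+|k|/2}v^{\pm1}z;q)_\infty}{(a^{-1/2}q^{1/2+|k|/2}u^{\pm1}z,\,a^{-1/2}q^{1/2+|k|/2}v^{\pm1}z^{-1};q)_\infty}\frac{dz}{2\pi i z},$$ $$I_m=P\sum_{k\in\mathbb Z}(q/a)^{|k|}w^k\int_{\mathbb T}\frac{(a^{-1/2}q^{1+|k|/2}v^{\pm1}z^{-1},\,a^{-1/2}q^{1+|k|/2}u^{\pm1}z;q)_\infty}{(a^{1/2}q^{|k|/2}v^{\pm1}z,\,a^{1/2}q^{|k|/2}u^{\pm1}z^{-1};q)_\infty}\frac{dz}{2\pi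 i z},$$ where $\mathbb T$ is the positively oriented unit circle. Then all integrands are continuous on $\mathbb T$, both sums over $k$ converge absolutely, and $$I_e=I_m .$$ If moreover $v^2\ne 1$, then $$I_e=E(v)+E(1/v),\qquad I_m=P\,\bigl(M(v)+M(1/v)\bigr).$$ -/

import Mathlib

/-- The infinite `q`-shifted factorial `(z;q)_∞ = ∏_{j ≥ 0} (1 - z q^j)` (used for `|q| < 1`). -/
noncomputable def qPochInf (z q : ℂ) : ℂ := ∏' j : ℕ, (1 - z * q ^ j)

/-- The finite `q`-shifted factorial `(z;q)_n = ∏_{j < n} (1 - z q^j)`. -/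
noncomputable def qPoch (z q : ℂ) (n : ℕ) : ℂ := ∏ j ∈ Finset.range n, (1 - z * q ^ j)

/-- The basic hypergeometric series `₂φ₁(A, B; C; q, Z)`. -/
noncomputable def phi21 (A B C q Z : ℂ) : ℂ :=
  ∑' n : ℕ, qPoch A q n * qPoch B q n / (qPoch q q n * qPoch C q n) * Z ^ n

/-- The integral `∫_𝕋 f(z) dz / (2πiz)` over the positively oriented unit circle. -/
noncomputable def torusIntegral1 (f : ℂ → ℂ) : ℂ :=
  (2 * (Real.pi : ℂ) * Complex.I)⁻¹ * ∮ z in C(0, 1), f z / z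

/-- Integrand of the electric index in the flux sector `k`. Here `r`, `s` stand for chosen square
roots `q^{1/2}`, `a^{1/2}`, so that `s * r ^ (1 + |k|)` is `a^{1/2} q^{1/2+|k|/2}` and
`s⁻¹ * r ^ (1 + |k|)` is `a^{-1/2} q^{1/2+|k|/2}`. -/
noncomputable def electricIntegrand (q r s u v : ℂ) (k : ℤ) (z : ℂ) : ℂ :=
  (qPochInf (s * r ^ (1 + k.natAbs) * u * z⁻¹) q *
      qPochInf (s * r ^ (1 + k.natAbs) * u⁻¹ * z⁻¹) q *
      qPochInf (s * r ^ (1 + k.natAbs) * v * z) q *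
      qPochInf (s * r ^ (1 + k.natAbs) * v⁻¹ * z) q) /
    (qPochInf (s⁻¹ * r ^ (1 + k.natAbs) * u * z) q *
      qPochInf (s⁻¹ * r ^ (1 + k.natAbs) * u⁻¹ * z) q *
      qPochInf (s⁻¹ * r ^ (1 + k.natAbs) * v * z⁻¹) q *
      qPochInf (s⁻¹ * r ^ (1 + k.natAbs) * v⁻¹ * z⁻¹) q)

/-- Contribution of the flux sector `k` to the electric index. -/
noncomputable def electricSector (q a r s u v w : ℂ) (k : ℤ) : ℂ :=
  a ^ k.natAbs * w ^ k * torusIntegral1 (electricIntegrand q r s u v k)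

/-- The electric superconformal index of the `U(1)`, `N_f = 2` theory. -/
noncomputable def electricIndex (q a r s u v w : ℂ) : ℂ :=
  ∑' k : ℤ, electricSector q a r s u v w k

/-- The prefactor `(q w^{±1}/a;q)_∞ / (a w^{±1};q)_∞ * (a u^{±1} v^{±1};q)_∞ /
(q u^{±1} v^{±1}/a;q)_∞` of the mirror index, the last two symbols being products over all four
choices of signs. -/
noncomputable def mirrorPrefactor (q a u v w : ℂ) : ℂ :=
  (qPochInf (q * w / a) q * qPochInf (q * w⁻¹ / a) q) /
      (qPochInf (a * w) q * qPochInf (a * w⁻¹) q) *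
    ((qPochInf (a * u * v) q * qPochInf (a * u * v⁻¹) q *
        qPochInf (a * u⁻¹ * v) q * qPochInf (a * u⁻¹ * v⁻¹) q) /
      (qPochInf (q * u * v / a) q * qPochInf (q * u * v⁻¹ / a) q *
        qPochInf (q * u⁻¹ * v / a) q * qPochInf (q * u⁻¹ * v⁻¹ / a) q))

/-- Integrand of the mirror index in the flux sector `k`: with `r = q^{1/2}`, `s = a^{1/2}`,
`s⁻¹ * r ^ (2 + |k|)` is `a^{-1/2} q^{1+|k|/2}` and `s * r ^ |k|` is `a^{1/2} q^{|k|/2}`. -/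
noncomputable def mirrorIntegrand (q r s u v : ℂ) (k : ℤ) (z : ℂ) : ℂ :=
  (qPochInf (s⁻¹ * r ^ (2 + k.natAbs) * v * z⁻¹) q *
      qPochInf (s⁻¹ * r ^ (2 + k.natAbs) * v⁻¹ * z⁻¹) q *
      qPochInf (s⁻¹ * r ^ (2 + k.natAbs) * u * z) q *
      qPochInf (s⁻¹ * r ^ (2 + k.natAbs) * u⁻¹ * z) q) /
    (qPochInf (s * r ^ k.natAbs * v * z) q *
      qPochInf (s * r ^ k.natAbs * v⁻¹ * z) q *
      qPochInf (s * r ^ k.natAbs * u * z⁻¹) q *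
      qPochInf (s * r ^ k.natAbs * u⁻¹ * z⁻¹) q)

/-- Contribution of the flux sector `k` to the mirror index, without the prefactor. -/
noncomputable def mirrorSector (q a r s u v w : ℂ) (k : ℤ) : ℂ :=
  (q / a) ^ k.natAbs * w ^ k * torusIntegral1 (mirrorIntegrand q r s u v k)

/-- The superconformal index of the mirror partner. -/
noncomputable def mirrorIndex (q a r s u v w : ℂ) : ℂ :=
  mirrorPrefactor q a u v w * ∑' k : ℤ, mirrorSector q a r s u v w k

/-- First summand of the `₂φ₁`-form of the electric index. -/
noncomputable def electricTerm (q a u v w : ℂ) : ℂ :=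
  (qPochInf (q * v ^ 2) q * qPochInf (a * u / v) q * qPochInf (a / (u * v)) q) /
      (qPochInf (1 / v ^ 2) q * qPochInf (q * v / (a * u)) q * qPochInf (q * u * v / a) q) *
    (phi21 (q * u * v / a) (q * v / (a * u)) (q * v ^ 2) q (a * w) *
      phi21 (q * u * v / a) (q * v / (a * u)) (q * v ^ 2) q (a * w⁻¹))

/-- The `₂φ₁`-form of the electric index: the first summand plus its image under `v ↦ 1/v`. -/
noncomputable def electricClosedForm (q a u v w : ℂ) : ℂ :=
  electricTerm q a u v w + electricTerm q a u v⁻¹ w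

/-- First summand in the bracket of the `₂φ₁`-form of the mirror index. -/
noncomputable def mirrorTerm (q a u v w : ℂ) : ℂ :=
  (qPochInf (q * v ^ 2) q * qPochInf (q * u / (a * v)) q * qPochInf (q / (a * u * v)) q) /
      (qPochInf (1 / v ^ 2) q * qPochInf (a * v / u) q * qPochInf (a * u * v) q) *
    (phi21 (a * u * v) (a * v / u) (q * v ^ 2) q (q * w / a) *
      phi21 (a * u * v) (a * v / u) (q * v ^ 2) q (q * w⁻¹ / a))

/-- The `₂φ₁`-form of the mirror index: the prefactor times the sum over `v ↦ 1/v`. -/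
noncomputable def mirrorClosedForm (q a u v w : ℂ) : ℂ :=
  mirrorPrefactor q a u v w * (mirrorTerm q a u v w + mirrorTerm q a u v⁻¹ w)

/-! The identity of closed forms holds term by term: E(v) = P M(v), and P is invariant under v ↦
1/v. Heine's q-analogue of Euler's transformation (`phi21_euler_transformation`), with A = quv/a, B
= qv/(au), C = qv², turns the argument aw^ε into (AB/C)aw^ε = qw^ε/a and the upper parameters into
C/A = av/u and C/B = auv. The infinite products that it produces, together with those in front of
the two series, assemble into P. The transformation itself is an identity of formal power series:
both sides solve the same second-order q-difference equation, whose solution is fixed by its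
constant term.

The indices are evaluated by residues. In flux sector k the integrand splits into a factor
holomorphic in z on the closed unit disc and a factor in 1/z. The latter has a partial fraction
expansion over two families of simple poles (`qPochInf_ratio_partialFraction`), obtained from
Lagrange interpolation for finite products by a limit. Integrating termwise with Cauchy's formula
gives, for each family, a constant times ∑ⱼ a^{2j} Tⱼ T_{j+|k|}, where Tⱼ are the coefficients of
the ₂φ₁ series. Summing against a^{|k|}w^k and putting k = m − n, j = min(m, n) gives the product of
the series at aw and a/w (`hasSum_int_factorization`). This yields I_e = E(v) + E(1/v).

The mirror index needs no second computation: apart from P, it is the electric index with a replaced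
by q/a, after z ↦ 1/z. The two families of poles are distinct only if v² ∉ q^ℤ, which the norm
bounds reduce to v² ≠ 1. The case v² = 1 follows since both indices are continuous in v and agree on
a punctured neighbourhood. -/

open Filter Topology

/-! ### Convergence, nonvanishing and analyticity of q-shifted factorials. -/

section QPochhammer

theorem qPoch_zero (z q : ℂ) : qPoch z q 0 = 1 := by simp [qPoch]

theorem qPoch_succ (z q : ℂ) (n : ℕ) : qPoch z q (n + 1) = qPoch z q n * (1 - z * q ^ n) := by
  simp [qPoch, Finset.prod_range_succ]

theorem qPoch_ne_zero {z q : ℂ} (h : ∀ j : ℕ, z * q ^ j ≠ 1) (n : ℕ) : qPoch z q n ≠ 0 :=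
  Finset.prod_ne_zero_iff.2 fun j _ => sub_ne_zero.2 (h j).symm

theorem summable_norm_mul_pow {q : ℂ} (hq : ‖q‖ < 1) (z : ℂ) :
    Summable fun j : ℕ => ‖-(z * q ^ j)‖ := by
  simpa using (summable_geometric_of_lt_one (norm_nonneg q) hq).mul_left ‖z‖

theorem tendsto_qPoch {q : ℂ} (hq : ‖q‖ < 1) (z : ℂ) :
    Tendsto (qPoch z q) atTop (𝓝 (qPochInf z q)) := by
  have h := (multipliable_one_add_of_summable (summable_norm_mul_pow hq z)).hasProd.tendsto_prod_nat
  simp only [← sub_eq_add_neg] at h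
  exact h

theorem qPochInf_ne_zero {q z : ℂ} (hq : ‖q‖ < 1) (h : ∀ j : ℕ, z * q ^ j ≠ 1) :
    qPochInf z q ≠ 0 := by
  have := tprod_one_add_ne_zero_of_summable (f := fun j : ℕ => -(z * q ^ j))
    (fun j => by rw [← sub_eq_add_neg]; exact sub_ne_zero.2 (h j).symm) (summable_norm_mul_pow hq z)
  simp only [← sub_eq_add_neg] at this
  exact this

theorem mul_pow_ne_one {q z : ℂ} (hq : ‖q‖ < 1) (hz : ‖z‖ < 1) (j : ℕ) : z * q ^ j ≠ 1 := by
  intro h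
  have h1 : ‖z‖ * ‖q‖ ^ j = 1 := by rw [← norm_pow, ← norm_mul, h, norm_one]
  have h2 : ‖q‖ ^ j ≤ 1 := pow_le_one₀ (norm_nonneg _) hq.le
  nlinarith [norm_nonneg z, norm_nonneg q]

theorem qPochInf_ne_zero_of_norm_lt {q z : ℂ} (hq : ‖q‖ < 1) (hz : ‖z‖ < 1) :
    qPochInf z q ≠ 0 :=
  qPochInf_ne_zero hq (mul_pow_ne_one hq hz)

theorem qPoch_add (z q : ℂ) (m n : ℕ) :
    qPoch z q (m + n) = qPoch z q m * qPoch (z * q ^ m) q n := by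
  simp [qPoch, Finset.prod_range_add, pow_add, mul_assoc]

theorem qPochInf_eq_mul {q : ℂ} (hq : ‖q‖ < 1) (z : ℂ) (n : ℕ) :
    qPochInf z q = qPoch z q n * qPochInf (z * q ^ n) q := by
  have h1 : Tendsto (fun m => qPoch z q (m + n)) atTop (𝓝 (qPochInf z q)) :=
    (tendsto_qPoch hq z).comp (tendsto_add_atTop_nat n)
  refine tendsto_nhds_unique h1 ?_
  simpa only [add_comm _ n, qPoch_add] using (tendsto_qPoch hq (z * q ^ n)).const_mul (qPoch z q n)

/-- On a ball of radius ‖z₀‖ + 1 the factors are dominated by a geometric series, so the partial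
products converge locally uniformly and the limit is holomorphic. -/
theorem differentiable_qPochInf {q : ℂ} (hq : ‖q‖ < 1) :
    Differentiable ℂ fun z => qPochInf z q := by
  intro z₀
  have hU : IsOpen (Metric.ball (0 : ℂ) (‖z₀‖ + 1)) := Metric.isOpen_ball
  have hs : Summable fun j : ℕ => (‖z₀‖ + 1) * ‖q‖ ^ j :=
    (summable_geometric_of_lt_one (norm_nonneg q) hq).mul_left _
  have hP := hs.hasProdLocallyUniformlyOn_nat_one_add (f := fun j z => -(z * q ^ j)) hU
    (Eventually.of_forall fun n x hx => by
      rw [norm_neg, norm_mul, norm_pow]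
      have : ‖x‖ < ‖z₀‖ + 1 := by simpa using hx
      gcongr) (fun n => by fun_prop)
  have hd := hP.tendstoLocallyUniformlyOn_finsetRange.differentiableOn
    (Eventually.of_forall fun n => by fun_prop) hU
  have := hd.differentiableAt (hU.mem_nhds (x := z₀) (by simp))
  simp only [← sub_eq_add_neg] at this
  exact this

theorem continuous_qPochInf_of_norm_lt {q : ℂ} (hq : ‖q‖ < 1) :
    Continuous fun z => qPochInf z q :=
  (differentiable_qPochInf hq).continuous

theorem exists_norm_le_of_tendsto {f : ℕ → ℂ} {l : ℂ} (h : Tendsto f atTop (𝓝 l)) :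
    ∃ M : ℝ, 0 ≤ M ∧ ∀ n, ‖f n‖ ≤ M := by
  obtain ⟨M, hM⟩ := (Metric.isBounded_range_of_tendsto f h).exists_norm_le
  exact ⟨M, (norm_nonneg _).trans (hM (f 0) ⟨0, rfl⟩), fun n => hM _ ⟨n, rfl⟩⟩

theorem tendsto_qPoch_div {q A B C D : ℂ} (hq : ‖q‖ < 1)
    (hC : ∀ j : ℕ, C * q ^ j ≠ 1) (hD : ∀ j : ℕ, D * q ^ j ≠ 1) :
    Tendsto (fun n => qPoch A q n * qPoch B q n / (qPoch D q n * qPoch C q n)) atTop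
      (𝓝 (qPochInf A q * qPochInf B q / (qPochInf D q * qPochInf C q))) :=
  ((tendsto_qPoch hq A).mul (tendsto_qPoch hq B)).div
    ((tendsto_qPoch hq D).mul (tendsto_qPoch hq C))
    (mul_ne_zero (qPochInf_ne_zero hq hD) (qPochInf_ne_zero hq hC))

end QPochhammer

/-! ### The q-binomial theorem and Heine's form of Euler's transformation. -/

section BasicHypergeometric

/-- The coefficient of `Z ^ n` in the series `₂φ₁(A, B; C; q, Z)`. -/
noncomputable def phiCoeff (A B C q : ℂ) (n : ℕ) : ℂ :=
  qPoch A q n * qPoch B q n / (qPoch q q n * qPoch C q n)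

theorem phiCoeff_zero (A B C q : ℂ) : phiCoeff A B C q 0 = 1 := by simp [phiCoeff, qPoch_zero]

theorem self_mul_pow_ne_one {q : ℂ} (hq : ‖q‖ < 1) (j : ℕ) : q * q ^ j ≠ 1 :=
  mul_pow_ne_one hq hq j

/-- This recurrence, cleared of denominators, is the coefficientwise form of the q-difference
equations used below. -/
theorem phiCoeff_succ {A B C q : ℂ} (hq : ‖q‖ < 1) (hC : ∀ j : ℕ, C * q ^ j ≠ 1) (n : ℕ) :
    phiCoeff A B C q (n + 1) * ((1 - q ^ (n + 1)) * (1 - C * q ^ n)) =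
      phiCoeff A B C q n * ((1 - A * q ^ n) * (1 - B * q ^ n)) := by
  have h1 := qPoch_ne_zero (self_mul_pow_ne_one hq) n
  have h2 := qPoch_ne_zero hC n
  have h3 : 1 - q * q ^ n ≠ 0 := sub_ne_zero.2 (self_mul_pow_ne_one hq n).symm
  have h4 : 1 - C * q ^ n ≠ 0 := sub_ne_zero.2 (hC n).symm
  simp only [phiCoeff, qPoch_succ, pow_succ']
  rw [div_mul_eq_mul_div, div_mul_eq_mul_div, div_eq_div_iff
    (mul_ne_zero (mul_ne_zero h1 h3) (mul_ne_zero h2 h4)) (mul_ne_zero h1 h2)]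
  ring

theorem exists_norm_phiCoeff_le {A B C q : ℂ} (hq : ‖q‖ < 1) (hC : ∀ j : ℕ, C * q ^ j ≠ 1) :
    ∃ M : ℝ, 0 ≤ M ∧ ∀ n, ‖phiCoeff A B C q n‖ ≤ M :=
  exists_norm_le_of_tendsto (tendsto_qPoch_div hq hC (self_mul_pow_ne_one hq))

theorem summable_norm_phiCoeff_mul_pow {A B C q Z : ℂ} (hq : ‖q‖ < 1)
    (hC : ∀ j : ℕ, C * q ^ j ≠ 1) (hZ : ‖Z‖ < 1) :
    Summable fun n => ‖phiCoeff A B C q n * Z ^ n‖ := by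
  obtain ⟨M, -, hM⟩ := exists_norm_phiCoeff_le (A := A) (B := B) hq hC
  refine Summable.of_nonneg_of_le (fun _ => norm_nonneg _) (fun n => ?_)
    ((summable_geometric_of_lt_one (norm_nonneg Z) hZ).mul_left M)
  rw [norm_mul, norm_pow]
  gcongr
  exact hM n

/-- The sum f satisfies (1 − x) f(x) = (1 − Dx) f(qx). Iterating N times and letting N → ∞ gives the
product, since f(q^N Z) → f(0) = 1. Setting B = C = 0 in `phiCoeff` yields the ₁φ₀ coefficients. -/
theorem qBinomial {D q Z : ℂ} (hq : ‖q‖ < 1) (hZ : ‖Z‖ < 1) :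
    ∑' n, phiCoeff D 0 0 q n * Z ^ n = qPochInf (D * Z) q / qPochInf Z q := by
  have h0 : ∀ j : ℕ, (0 : ℂ) * q ^ j ≠ 1 := by simp
  set f : ℂ → ℂ := fun x => ∑' n, phiCoeff D 0 0 q n * x ^ n with hf
  have hs : ∀ x : ℂ, ‖x‖ < 1 → Summable fun n => phiCoeff D 0 0 q n * x ^ n := fun x hx =>
    (summable_norm_phiCoeff_mul_pow hq h0 hx).of_norm
  have hqx : ∀ x : ℂ, ‖x‖ < 1 → ‖q * x‖ < 1 := fun x hx => by
    rw [norm_mul]; nlinarith [norm_nonneg x, norm_nonneg q]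
  have hrec : ∀ x : ℂ, ‖x‖ < 1 → f x * (1 - x) = (1 - D * x) * f (q * x) := by
    intro x hx
    have e1 := (hs x hx).tsum_eq_zero_add
    have e2 := (hs _ (hqx x hx)).tsum_eq_zero_add
    have s1 := (summable_nat_add_iff 1).2 (hs x hx)
    have s2 := (summable_nat_add_iff 1).2 (hs _ (hqx x hx))
    have key : f x - f (q * x) = x * f x - D * x * f (q * x) := by
      have e3 : f x - f (q * x) = ∑' n, (phiCoeff D 0 0 q (n + 1) * x ^ (n + 1) -
          phiCoeff D 0 0 q (n + 1) * (q * x) ^ (n + 1)) := by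
        rw [s1.tsum_sub s2]
        linear_combination e1 - e2
      rw [e3, ← tsum_mul_left, ← tsum_mul_left,
        ← ((hs x hx).mul_left x).tsum_sub ((hs _ (hqx x hx)).mul_left (D * x))]
      refine tsum_congr fun n => ?_
      have := phiCoeff_succ (A := D) (B := 0) hq h0 n
      simp only [mul_pow]
      linear_combination x ^ (n + 1) * this
    linear_combination key
  have hpow : ∀ N : ℕ, ‖q ^ N * Z‖ < 1 := fun N => by
    rw [norm_mul, norm_pow]
    have : ‖q‖ ^ N ≤ 1 := pow_le_one₀ (norm_nonneg _) hq.le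
    nlinarith [norm_nonneg Z]
  have hiter : ∀ N : ℕ, f Z * qPoch Z q N = qPoch (D * Z) q N * f (q ^ N * Z) := by
    intro N
    induction N with
    | zero => simp [qPoch_zero]
    | succ N ih =>
      have := hrec _ (hpow N)
      rw [qPoch_succ, qPoch_succ, pow_succ', mul_assoc q]
      linear_combination (1 - Z * q ^ N) * ih + qPoch (D * Z) q N * this
  have hlim : Tendsto (fun N : ℕ => f (q ^ N * Z)) atTop (𝓝 1) := by
    have h := tendsto_tsum_of_dominated_convergence (𝓕 := atTop)
      (f := fun (N : ℕ) n => phiCoeff D 0 0 q n * (q ^ N * Z) ^ n)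
      (g := fun n => phiCoeff D 0 0 q n * (0 : ℂ) ^ n)
      (summable_norm_phiCoeff_mul_pow (A := D) (B := 0) hq h0 hZ) (fun n => by
        have : Tendsto (fun N : ℕ => q ^ N * Z) atTop (𝓝 0) := by
          simpa using (tendsto_pow_atTop_nhds_zero_of_norm_lt_one hq).mul_const Z
        exact (this.pow n).const_mul _)
      (Eventually.of_forall fun N n => by
        simp only [norm_mul, norm_pow, mul_pow]
        have h1 : (‖q‖ ^ N) ^ n ≤ 1 :=
          pow_le_one₀ (by positivity) (pow_le_one₀ (norm_nonneg _) hq.le)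
        have h2 : 0 ≤ ‖phiCoeff D 0 0 q n‖ * ‖Z‖ ^ n := by positivity
        nlinarith)
    rw [tsum_eq_single 0 (fun n hn => by simp [hn])] at h
    simpa [phiCoeff_zero] using h
  have h1 := (tendsto_qPoch hq Z).const_mul (f Z)
  have h2 := (tendsto_qPoch hq (D * Z)).mul hlim
  simp only [hiter] at h1
  rw [eq_div_iff (qPochInf_ne_zero_of_norm_lt hq hZ)]
  simpa using tendsto_nhds_unique h1 h2

theorem PowerSeries.constantCoeff_rescale (c : ℂ) (F : PowerSeries ℂ) :
    PowerSeries.constantCoeff (PowerSeries.rescale c F) = PowerSeries.constantCoeff F := by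
  rw [← PowerSeries.coeff_zero_eq_constantCoeff_apply, PowerSeries.coeff_rescale]
  simp

open PowerSeries in
/-- The `q`-difference equation of `₂φ₁(A, B; C; q, Z)` has a unique formal solution with given
constant term. -/
theorem phiCoeff_of_qDifference {A B C q : ℂ} (hq0 : q ≠ 0) (hq : ‖q‖ < 1)
    (hC : ∀ j : ℕ, C * q ^ j ≠ 1)
    {F : PowerSeries ℂ} (h0 : coeff 0 F = 1)
    (hF : (1 - X) * F - (PowerSeries.C (1 + C / q) - PowerSeries.C (A + B) * X) * rescale q F +
      (PowerSeries.C (C / q) - PowerSeries.C (A * B) * X) * rescale q (rescale q F) = 0) (n : ℕ) :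
    coeff n F = phiCoeff A B C q n := by
  induction n with
  | zero => rw [h0, phiCoeff_zero]
  | succ n ih =>
    have h := congrArg (coeff (n + 1)) hF
    simp only [sub_mul, one_mul, LinearMap.map_add, LinearMap.map_sub, mul_assoc,
      coeff_C_mul, coeff_succ_X_mul,
      coeff_rescale, map_zero] at h
    -- In degree n + 1 the equation multiplies the new coefficient by (1 − q^(n+1))(1 − Cq^n), which
    -- is nonzero, so it is determined by the previous one.
    have h3 : 1 - q ^ (n + 1) ≠ 0 := by
      rw [pow_succ']; exact sub_ne_zero.2 (self_mul_pow_ne_one hq n).symm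
    have h4 : 1 - C * q ^ n ≠ 0 := sub_ne_zero.2 (hC n).symm
    refine mul_right_cancel₀ (mul_ne_zero h3 h4) ?_
    rw [phiCoeff_succ hq hC, ← ih]
    have : C / q * q ^ (n + 1) = C * q ^ n := by rw [pow_succ']; field_simp
    linear_combination h - (q ^ (n + 1) - 1) * coeff (n + 1) F * this

open PowerSeries in
theorem qDifference_mk_phiCoeff {A B C q : ℂ} (hq0 : q ≠ 0) (hq : ‖q‖ < 1)
    (hC : ∀ j : ℕ, C * q ^ j ≠ 1) :
    let F : PowerSeries ℂ := mk (phiCoeff A B C q)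
    (1 - X) * F - (PowerSeries.C (1 + C / q) - PowerSeries.C (A + B) * X) * rescale q F +
      (PowerSeries.C (C / q) - PowerSeries.C (A * B) * X) * rescale q (rescale q F) = 0 := by
  intro F
  ext n
  rcases n with _ | n
  · simp [sub_mul, mul_assoc, constantCoeff_rescale, F]
    ring
  · simp only [sub_mul, one_mul, LinearMap.map_add, LinearMap.map_sub, mul_assoc,
      coeff_C_mul, coeff_succ_X_mul,
      coeff_rescale, map_zero, F, coeff_mk]
    have : C / q * q ^ (n + 1) = C * q ^ n := by rw [pow_succ']; field_simp
    linear_combination phiCoeff_succ (A := A) (B := B) hq hC n +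
      (q ^ (n + 1) - 1) * phiCoeff A B C q (n + 1) * this

open PowerSeries in
theorem qDifference_mk_qBinomial {D q : ℂ} (hq : ‖q‖ < 1) :
    (1 - PowerSeries.C D * X) * rescale q (mk (phiCoeff D 0 0 q)) =
      (1 - X) * mk (phiCoeff D 0 0 q) := by
  have h0 : ∀ j : ℕ, (0 : ℂ) * q ^ j ≠ 1 := by simp
  ext n
  rcases n with _ | n
  · simp [sub_mul, mul_assoc, constantCoeff_rescale]
  · simp only [sub_mul, one_mul, LinearMap.map_sub, mul_assoc,
      coeff_C_mul, coeff_succ_X_mul,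
      coeff_rescale, coeff_mk]
    linear_combination -phiCoeff_succ (A := D) (B := 0) hq h0 n

open PowerSeries in
-- The coefficient form of the Euler transformation: the product of the q-binomial series H with the
-- rescaled ₂φ₁ series G satisfies the q-difference equation of ₂φ₁(A, B; C), so uniqueness applies.
theorem phiCoeff_eq_sum_antidiagonal {A B C q : ℂ} (hq0 : q ≠ 0) (hq : ‖q‖ < 1)
    (hA : A ≠ 0) (hB : B ≠ 0) (hC0 : C ≠ 0) (hC : ∀ j : ℕ, C * q ^ j ≠ 1) (n : ℕ) :
    phiCoeff A B C q n = ∑ p ∈ Finset.HasAntidiagonal.antidiagonal n, phiCoeff (A * B / C) 0 0 q p.1 *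
      ((A * B / C) ^ p.2 * phiCoeff (C / A) (C / B) C q p.2) := by
  set D := A * B / C with hD
  set H : PowerSeries ℂ := mk (phiCoeff D 0 0 q) with hH
  set G₀ : PowerSeries ℂ := mk (phiCoeff (C / A) (C / B) C q) with hG₀
  set G := rescale D G₀ with hG
  have hcoeff : coeff n (H * G) = ∑ p ∈ Finset.HasAntidiagonal.antidiagonal n, phiCoeff D 0 0 q p.1 *
      (D ^ p.2 * phiCoeff (C / A) (C / B) C q p.2) := by
    simp [coeff_mul, hH, hG, hG₀, coeff_rescale]
  rw [← hcoeff]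
  symm
  refine phiCoeff_of_qDifference hq0 hq hC ?_ ?_ n
  · simp [hH, hG, hG₀, phiCoeff_zero, constantCoeff_rescale]
  have e1 := qDifference_mk_qBinomial (D := D) hq
  rw [← hH] at e1
  have rX : ∀ c : ℂ, rescale c (X : PowerSeries ℂ) = PowerSeries.C c * X := fun c => by
    rw [rescale_X]
  have rC : ∀ c d : ℂ, rescale c (PowerSeries.C d) = PowerSeries.C d := fun c d => by
    ext m; rcases m with _ | m <;> simp [coeff_rescale, coeff_C]
  have e2 := congrArg (rescale q) e1
  simp only [map_mul, map_sub, map_one, rX, rC] at e2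
  have e3 := congrArg (rescale D) (qDifference_mk_phiCoeff (A := C / A) (B := C / B) hq0 hq hC)
  simp only [map_mul, map_sub, map_add, map_one, map_zero, rX, rC] at e3
  have comm : ∀ F : PowerSeries ℂ, rescale D (rescale q F) = rescale q (rescale D F) := fun F => by
    rw [rescale_rescale, rescale_rescale, mul_comm]
  simp only [comm, ← hG₀, ← hG] at e3
  have hne : ∀ c : ℂ, (1 - PowerSeries.C c * X : PowerSeries ℂ) ≠ 0 := fun c h => by
    simpa using congrArg (coeff 0) h
  have c1 : (PowerSeries.C A + PowerSeries.C B : PowerSeries ℂ) =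
      PowerSeries.C D * (PowerSeries.C (C / A) + PowerSeries.C (C / B)) := by
    rw [← map_add, ← map_add, ← map_mul]
    congr 1
    rw [hD]; field_simp; ring
  have c2 : (PowerSeries.C (C / q) : PowerSeries ℂ) =
      PowerSeries.C D * (PowerSeries.C (C / A) * PowerSeries.C (C / B)) * PowerSeries.C q⁻¹ := by
    rw [← map_mul, ← map_mul, ← map_mul]
    congr 1
    rw [hD]; field_simp
  have c3 : (PowerSeries.C A * PowerSeries.C B : PowerSeries ℂ) =
      PowerSeries.C D * (PowerSeries.C D * (PowerSeries.C (C / A) * PowerSeries.C (C / B))) := by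
    rw [← map_mul, ← map_mul, ← map_mul, ← map_mul]
    congr 1
    rw [hD]; field_simp
  have c4 : (PowerSeries.C q⁻¹ * PowerSeries.C q : PowerSeries ℂ) = 1 := by
    rw [← map_mul, inv_mul_cancel₀ hq0, map_one]
  -- After multiplication by (1 − DX)(1 − DqX), `e1` and `e2` express H(qX) and H(q²X) through H,
  -- and what is left is the equation `e3` of G.
  refine mul_left_cancel₀ (mul_ne_zero (hne D) (hne (D * q))) ?_
  rw [mul_zero]
  simp only [map_mul, map_add, map_one] at e3 ⊢
  rw [c1, c3]
  rw [c2] at e3 ⊢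
  generalize PowerSeries.C D = d at *
  generalize PowerSeries.C (C / A) = α at *
  generalize PowerSeries.C (C / B) = β at *
  generalize PowerSeries.C q = p at *
  generalize PowerSeries.C q⁻¹ = p' at *
  linear_combination
    (-(1 - d * p * X) * (1 + d * (α * β) * p' - d * (α + β) * X) * rescale q G +
      (1 - d * p * X) * (d * (α * β) * p') * (1 - p * X) * rescale q (rescale q G)) * e1 +
    (1 - d * X) * (1 - d * p * X) * (d * (α * β) * p') * rescale q (rescale q G) * e2 +
    (1 - X) * (1 - d * p * X) * H * e3 +
    ((1 - d * X) * (1 - d * p * X) * d * d * α * β * X * rescale q (rescale q H) *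
      rescale q (rescale q G) -
      (1 - d * p * X) * (1 - X) * H * rescale q (rescale q G) * d * α * β * X) * c4

theorem phi21_eq_tsum (A B C q Z : ℂ) : phi21 A B C q Z = ∑' n, phiCoeff A B C q n * Z ^ n := rfl

/-- The `q`-analogue of Euler's transformation, due to Heine. -/
theorem phi21_euler_transformation {A B C q Z : ℂ} (hq0 : q ≠ 0) (hq : ‖q‖ < 1)
    (hA : A ≠ 0) (hB : B ≠ 0) (hC0 : C ≠ 0) (hC : ∀ j : ℕ, C * q ^ j ≠ 1)
    (hZ : ‖Z‖ < 1) (hZ' : ‖A * B / C * Z‖ < 1) :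
    phi21 A B C q Z = qPochInf (A * B / C * Z) q / qPochInf Z q *
      phi21 (C / A) (C / B) C q (A * B / C * Z) := by
  rw [← qBinomial hq hZ, phi21_eq_tsum, phi21_eq_tsum,
    tsum_mul_tsum_eq_tsum_sum_antidiagonal_of_summable_norm
      (summable_norm_phiCoeff_mul_pow hq (by simp) hZ) (summable_norm_phiCoeff_mul_pow hq hC hZ')]
  refine tsum_congr fun n => ?_
  rw [phiCoeff_eq_sum_antidiagonal hq0 hq hA hB hC0 hC, Finset.sum_mul]
  refine Finset.sum_congr rfl fun p hp => ?_
  rw [← Finset.HasAntidiagonal.mem_antidiagonal.1 hp, pow_add, mul_pow]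
  ring

end BasicHypergeometric

/-! ### Partial fractions of quotients of q-shifted factorials, finite and infinite. -/

section PartialFractions

/-- Two monic polynomials of the same degree differ by one of lower degree, which equals its
Lagrange interpolant at the nodes b; there the second polynomial vanishes. -/
theorem prod_sub_div_prod_sub {ι : Type*} [DecidableEq ι] (s : Finset ι) (g b : ι → ℂ)
    (hb : Set.InjOn b s) {x : ℂ} (hx : ∀ i ∈ s, x ≠ b i) :
    (∏ i ∈ s, (x - g i)) / ∏ i ∈ s, (x - b i) =
      1 + ∑ i ∈ s, (∏ l ∈ s, (b i - g l)) / (∏ l ∈ s.erase i, (b i - b l)) * (x - b i)⁻¹ := by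
  have hne : ∏ i ∈ s, (x - b i) ≠ 0 :=
    Finset.prod_ne_zero_iff.2 fun i hi => sub_ne_zero.2 (hx i hi)
  have hdeg : (Lagrange.nodal s g - Lagrange.nodal s b).degree < s.card := by
    have h := Polynomial.degree_sub_lt_left (p := Lagrange.nodal s g) (q := Lagrange.nodal s b)
      (by rw [Lagrange.degree_nodal, Lagrange.degree_nodal]) (Lagrange.nodal_monic).ne_zero
      (by rw [Lagrange.nodal_monic.leadingCoeff, Lagrange.nodal_monic.leadingCoeff])
    rwa [Lagrange.degree_nodal] at h
  have h := congrArg (Polynomial.eval x) (Lagrange.eq_interpolate hb hdeg)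
  rw [Lagrange.eval_interpolate_not_at_node _ hx, Polynomial.eval_sub, Lagrange.eval_nodal,
    Lagrange.eval_nodal] at h
  rw [div_eq_iff hne, add_mul, one_mul, mul_comm (∑ i ∈ s, _), ← sub_eq_iff_eq_add', h]
  congr 1
  refine Finset.sum_congr rfl fun i hi => ?_
  rw [Polynomial.eval_sub, Lagrange.eval_nodal, Lagrange.eval_nodal,
    Finset.prod_eq_zero (f := fun l => b i - b l) hi (sub_self _), sub_zero, Lagrange.nodalWeight, Finset.prod_inv_distrib]
  ring

/-- The previous expansion at x = 1/y minus the one at x = 0, using (1/y − b)⁻¹ + b⁻¹ = b⁻¹(1 −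
by)⁻¹. The constant is now the limit as y → ∞, a form that tends to zero in the application. -/
theorem prod_one_sub_div_prod_one_sub {ι : Type*} [DecidableEq ι] (s : Finset ι) (g b : ι → ℂ)
    (hb : Set.InjOn b s) (hb0 : ∀ i ∈ s, b i ≠ 0) {y : ℂ} (hy0 : y ≠ 0)
    (hy : ∀ i ∈ s, b i * y ≠ 1) :
    (∏ i ∈ s, (1 - g i * y)) / ∏ i ∈ s, (1 - b i * y) =
      ∏ i ∈ s, g i / b i + ∑ i ∈ s, (∏ l ∈ s, (1 - g l / b i)) /
        (∏ l ∈ s.erase i, (1 - b l / b i)) / (1 - b i * y) := by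
  have h1 := prod_sub_div_prod_sub s g b hb (x := y⁻¹) fun i hi h => hy i hi (by
    rw [← h, inv_mul_cancel₀ hy0])
  have h0 := prod_sub_div_prod_sub s g b hb (x := 0) fun i hi h => hb0 i hi h.symm
  have e1 : (∏ i ∈ s, (y⁻¹ - g i)) / ∏ i ∈ s, (y⁻¹ - b i) =
      (∏ i ∈ s, (1 - g i * y)) / ∏ i ∈ s, (1 - b i * y) := by
    rw [← Finset.prod_div_distrib, ← Finset.prod_div_distrib]
    refine Finset.prod_congr rfl fun i hi => ?_
    rw [show y⁻¹ - g i = y⁻¹ * (1 - g i * y) by field_simp,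
      show y⁻¹ - b i = y⁻¹ * (1 - b i * y) by field_simp, mul_div_mul_left _ _ (inv_ne_zero hy0)]
  have e0 : (∏ i ∈ s, (0 - g i)) / ∏ i ∈ s, (0 - b i) = ∏ i ∈ s, g i / b i := by
    rw [← Finset.prod_div_distrib]
    refine Finset.prod_congr rfl fun i _ => ?_
    rw [zero_sub, zero_sub, neg_div_neg_eq]
  rw [e1] at h1
  rw [e0] at h0
  rw [h1, h0, add_assoc, ← Finset.sum_add_distrib]
  congr 1
  refine Finset.sum_congr rfl fun i hi => ?_
  have hbi := hb0 i hi
  have hyi : 1 - b i * y ≠ 0 := sub_ne_zero.2 (hy i hi).symm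
  have e2 : ∏ l ∈ s, (1 - g l / b i) = (∏ l ∈ s, (b i - g l)) / b i ^ s.card := by
    rw [← Finset.prod_const, ← Finset.prod_div_distrib]
    exact Finset.prod_congr rfl fun l _ => by field_simp
  have e3 : ∏ l ∈ s.erase i, (1 - b l / b i) =
      (∏ l ∈ s.erase i, (b i - b l)) / b i ^ (s.card - 1) := by
    rw [← Finset.card_erase_of_mem hi, ← Finset.prod_const, ← Finset.prod_div_distrib]
    exact Finset.prod_congr rfl fun l _ => by field_simp
  have hE : ∏ l ∈ s.erase i, (b i - b l) ≠ 0 := Finset.prod_ne_zero_iff.2 fun l hl =>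
    sub_ne_zero.2 fun h => (Finset.mem_erase.1 hl).1
      (hb (Finset.mem_of_mem_erase hl) hi h.symm)
  have hcard : b i ^ s.card = b i ^ (s.card - 1) * b i := by
    rw [← pow_succ, Nat.sub_add_cancel (Finset.card_pos.2 ⟨i, hi⟩)]
  rw [e2, e3, hcard, show y⁻¹ - b i = (1 - b i * y) / y by field_simp, zero_sub]
  field_simp
  ring

/-- The product `∏_{i < j} q ^ {-(i + 1)}`. -/
noncomputable def invPowProd (q : ℂ) (j : ℕ) : ℂ := ∏ i ∈ Finset.range j, (q ^ (i + 1))⁻¹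

theorem invPowProd_ne_zero {q : ℂ} (hq0 : q ≠ 0) (j : ℕ) : invPowProd q j ≠ 0 :=
  Finset.prod_ne_zero_iff.2 fun _ _ => inv_ne_zero (pow_ne_zero _ hq0)

/-- Reversing the order turns the factors into 1 − xq^{−(i+1)} = −xq^{−(i+1)}(1 − q^{i+1}/x). -/
theorem prod_range_one_sub_div_pow {q x : ℂ} (hq0 : q ≠ 0) (hx : x ≠ 0) (j : ℕ) :
    ∏ l ∈ Finset.range j, (1 - x * q ^ l / q ^ j) = (-x) ^ j * invPowProd q j * qPoch (q / x) q j := by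
  have hc : (-x) ^ j = ∏ _i ∈ Finset.range j, (-x) := by rw [Finset.prod_const, Finset.card_range]
  rw [← Finset.prod_range_reflect, invPowProd, qPoch, hc, ← Finset.prod_mul_distrib,
    ← Finset.prod_mul_distrib]
  refine Finset.prod_congr rfl fun i hi => ?_
  have hi' := Finset.mem_range.1 hi
  have : q ^ j = q ^ (j - 1 - i) * q ^ (i + 1) := by rw [← pow_add]; congr 1; omega
  rw [this, pow_succ]
  field_simp
  ring

theorem prod_range_one_sub_div_pow_of_le {q x : ℂ} (hq0 : q ≠ 0) (hx : x ≠ 0) {j N : ℕ}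
    (hj : j ≤ N) :
    ∏ l ∈ Finset.range N, (1 - x * q ^ l / q ^ j) =
      (-x) ^ j * invPowProd q j * qPoch (q / x) q j * qPoch x q (N - j) := by
  obtain ⟨m, rfl⟩ := Nat.exists_eq_add_of_le hj
  rw [Finset.prod_range_add, prod_range_one_sub_div_pow hq0 hx, Nat.add_sub_cancel_left, qPoch,
    qPoch]
  congr 1
  refine Finset.prod_congr rfl fun i _ => ?_
  rw [pow_add]
  field_simp

theorem prod_erase_range_add (f : ℕ → ℂ) (j m : ℕ) :
    ∏ l ∈ (Finset.range (j + 1 + m)).erase j, f l =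
      (∏ l ∈ Finset.range j, f l) * ∏ i ∈ Finset.range m, f (j + 1 + i) := by
  induction m with
  | zero =>
    rw [add_zero, Finset.range_add_one, Finset.erase_insert Finset.notMem_range_self]
    simp
  | succ m ih =>
    rw [Finset.prod_range_succ, ← mul_assoc, ← ih, ← add_assoc, Finset.range_add_one,
      Finset.erase_insert_of_ne (by omega), Finset.prod_insert (by simp), mul_comm]

theorem prod_erase_one_sub_div_pow {q : ℂ} (hq0 : q ≠ 0) {j N : ℕ} (hj : j < N) :
    ∏ l ∈ (Finset.range N).erase j, (1 - q ^ l / q ^ j) =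
      (-1) ^ j * invPowProd q j * qPoch q q j * qPoch q q (N - j - 1) := by
  obtain ⟨m, rfl⟩ := Nat.exists_eq_add_of_le (Nat.succ_le_of_lt hj)
  rw [Nat.succ_eq_add_one, prod_erase_range_add, show j + 1 + m - j - 1 = m by omega]
  have h := prod_range_one_sub_div_pow hq0 one_ne_zero j
  simp only [one_mul, div_one] at h
  rw [h, qPoch, qPoch]
  congr 1
  refine Finset.prod_congr rfl fun i _ => ?_
  rw [pow_add, pow_succ]
  field_simp

/-- The residue factor that the `j`-th pole of one of the two families contributes to the partial
fraction expansion of a quotient of `q`-shifted factorials of length `N`. -/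
noncomputable def residueCoeff (q x₁ x₂ x₃ : ℂ) (N j : ℕ) : ℂ :=
  (x₁ * x₂ / x₃) ^ j * phiCoeff (q / x₁) (q / x₂) (q / x₃) q j *
    (qPoch x₁ q (N - j) * qPoch x₂ q (N - j) / (qPoch q q (N - j - 1) * qPoch x₃ q (N - j)))

/-- With two products above and two below, the quadratic powers of q collected in `invPowProd`
cancel, so only the geometric factor (x₁x₂/x₃)^j survives. -/
theorem residueCoeff_eq {q x₁ x₂ x₃ : ℂ} (hq0 : q ≠ 0) (h₁ : x₁ ≠ 0)
    (h₂ : x₂ ≠ 0) (h₃ : x₃ ≠ 0) {j N : ℕ} (hj : j < N) :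
    (∏ l ∈ Finset.range N, (1 - x₁ * q ^ l / q ^ j)) *
        (∏ l ∈ Finset.range N, (1 - x₂ * q ^ l / q ^ j)) /
      ((∏ l ∈ (Finset.range N).erase j, (1 - q ^ l / q ^ j)) *
        ∏ l ∈ Finset.range N, (1 - x₃ * q ^ l / q ^ j)) = residueCoeff q x₁ x₂ x₃ N j := by
  rw [prod_range_one_sub_div_pow_of_le hq0 h₁ hj.le, prod_range_one_sub_div_pow_of_le hq0 h₂ hj.le,
    prod_range_one_sub_div_pow_of_le hq0 h₃ hj.le, prod_erase_one_sub_div_pow hq0 hj,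
    residueCoeff, phiCoeff]
  have hθ := invPowProd_ne_zero hq0 j
  have h4 : (-x₃) ^ j ≠ 0 := pow_ne_zero _ (neg_ne_zero.2 h₃)
  have e : (x₁ * x₂ / x₃) ^ j = (-x₁) ^ j * (-x₂) ^ j / ((-1) ^ j * (-x₃) ^ j) := by
    rw [← mul_pow, ← mul_pow, ← div_pow]; congr 1; field_simp
  rw [e]
  simp only [div_mul_div_comm]
  rw [show (-x₁) ^ j * invPowProd q j * qPoch (q / x₁) q j * qPoch x₁ q (N - j) *
      ((-x₂) ^ j * invPowProd q j * qPoch (q / x₂) q j * qPoch x₂ q (N - j)) =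
      (invPowProd q j * invPowProd q j) * ((-x₁) ^ j * (-x₂) ^ j *
      (qPoch (q / x₁) q j * qPoch (q / x₂) q j) * (qPoch x₁ q (N - j) * qPoch x₂ q (N - j))) by ring,
    show (-1) ^ j * invPowProd q j * qPoch q q j * qPoch q q (N - j - 1) *
      ((-x₃) ^ j * invPowProd q j * qPoch (q / x₃) q j * qPoch x₃ q (N - j)) =
      (invPowProd q j * invPowProd q j) * ((-1) ^ j * (-x₃) ^ j *
      (qPoch q q j * qPoch (q / x₃) q j) * (qPoch q q (N - j - 1) * qPoch x₃ q (N - j))) by ring,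
    mul_div_mul_left _ _ (mul_ne_zero hθ hθ)]

/-- The nodes b₁q^i and b₂q^i are indexed together by a disjoint sum. They are distinct because q is
not a root of unity and b₂/b₁ is not a power of q. -/
theorem qPoch_ratio_partialFraction {q g₁ g₂ b₁ b₂ y : ℂ} (hq0 : q ≠ 0)
    (hq1 : ∀ j : ℕ, q * q ^ j ≠ 1)
    (hg₁ : g₁ ≠ 0) (hg₂ : g₂ ≠ 0) (hb₁ : b₁ ≠ 0) (hb₂ : b₂ ≠ 0) (hy0 : y ≠ 0)
    (hb : ∀ m : ℤ, b₂ / b₁ ≠ q ^ m)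
    (hy₁ : ∀ j : ℕ, b₁ * y * q ^ j ≠ 1) (hy₂ : ∀ j : ℕ, b₂ * y * q ^ j ≠ 1) (N : ℕ) :
    qPoch (g₁ * y) q N * qPoch (g₂ * y) q N / (qPoch (b₁ * y) q N * qPoch (b₂ * y) q N) =
      (g₁ * g₂ / (b₁ * b₂)) ^ N +
      (∑ j ∈ Finset.range N, residueCoeff q (g₁ / b₁) (g₂ / b₁) (b₂ / b₁) N j /
          (1 - b₁ * y * q ^ j) +
        ∑ j ∈ Finset.range N, residueCoeff q (g₁ / b₂) (g₂ / b₂) (b₁ / b₂) N j /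
          (1 - b₂ * y * q ^ j)) := by
  have hinj : ∀ i j : ℕ, q ^ i = q ^ j → i = j := by
    have key : ∀ i m : ℕ, q ^ i ≠ q ^ (i + (m + 1)) := fun i m h => by
      rw [pow_add] at h
      have := mul_left_cancel₀ (pow_ne_zero i hq0) ((mul_one _).trans h)
      exact hq1 m (by rw [← pow_succ', ← this])
    intro i j h
    rcases lt_trichotomy i j with hij | hij | hij
    · obtain ⟨m, rfl⟩ := Nat.exists_eq_add_of_lt hij
      exact absurd h (key i m)
    · exact hij
    · obtain ⟨m, rfl⟩ := Nat.exists_eq_add_of_lt hij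
      exact absurd h.symm (key j m)
  have hcross : ∀ i j : ℕ, b₁ * q ^ i ≠ b₂ * q ^ j := fun i j h => hb (i - j) (by
    rw [zpow_sub₀ hq0, zpow_natCast, zpow_natCast, div_eq_div_iff hb₁ (pow_ne_zero _ hq0), ← h]
    ring)
  have hpf := prod_one_sub_div_prod_one_sub ((Finset.range N).disjSum (Finset.range N))
    (Sum.elim (fun i => g₁ * q ^ i) fun i => g₂ * q ^ i)
    (Sum.elim (fun i => b₁ * q ^ i) fun i => b₂ * q ^ i)
    (by
      rintro (i | i) - (j | j) - h
      · exact congrArg _ (hinj _ _ (mul_left_cancel₀ hb₁ h))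
      · exact absurd h (hcross i j)
      · exact absurd h.symm (hcross j i)
      · exact congrArg _ (hinj _ _ (mul_left_cancel₀ hb₂ h)))
    (by rintro (i | i) - <;> simp [hb₁, hb₂, hq0]) hy0
    (by
      rintro (i | i) -
      · simpa [mul_right_comm] using hy₁ i
      · simpa [mul_right_comm] using hy₂ i)
  have erase_inl : ∀ j, ((Finset.range N).disjSum (Finset.range N)).erase (Sum.inl j) =
      ((Finset.range N).erase j).disjSum (Finset.range N) := fun j => by
    ext (i | i) <;> simp
  have erase_inr : ∀ j, ((Finset.range N).disjSum (Finset.range N)).erase (Sum.inr j) =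
      (Finset.range N).disjSum ((Finset.range N).erase j) := fun j => by
    ext (i | i) <;> simp
  have fac : ∀ g b : ℂ, ∀ i j : ℕ, 1 - g * q ^ i / (b * q ^ j) = 1 - g / b * q ^ i / q ^ j := by
    intro g b i j
    rw [mul_div_mul_comm, mul_div_assoc]
  simp only [Finset.prod_disjSum, Finset.sum_disjSum, Sum.elim_inl, Sum.elim_inr, erase_inl,
    erase_inr, fac, div_self hb₁, div_self hb₂, one_mul] at hpf
  simp only [qPoch]
  simp only [mul_right_comm _ _ y] at hpf
  rw [hpf]
  congr 1
  · rw [← Finset.prod_mul_distrib, Finset.prod_congr rfl (g := fun _ => g₁ * g₂ / (b₁ * b₂)),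
      Finset.prod_const, Finset.card_range]
    intro i _
    field_simp
  · congr 1
    · refine Finset.sum_congr rfl fun j hj => ?_
      rw [residueCoeff_eq hq0 (div_ne_zero hg₁ hb₁) (div_ne_zero hg₂ hb₁) (div_ne_zero hb₂ hb₁)
        (Finset.mem_range.1 hj)]
    · refine Finset.sum_congr rfl fun j hj => ?_
      rw [← residueCoeff_eq hq0 (div_ne_zero hg₁ hb₂) (div_ne_zero hg₂ hb₂) (div_ne_zero hb₁ hb₂)
        (Finset.mem_range.1 hj), mul_comm (∏ l ∈ (Finset.range N).erase j, _)]

/-- The limit of `residueCoeff` as the length tends to infinity. -/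
noncomputable def residueCoeffInf (q x₁ x₂ x₃ : ℂ) (j : ℕ) : ℂ :=
  (x₁ * x₂ / x₃) ^ j * phiCoeff (q / x₁) (q / x₂) (q / x₃) q j *
    (qPochInf x₁ q * qPochInf x₂ q / (qPochInf q q * qPochInf x₃ q))

theorem tendsto_residue_ratio {q x₁ x₂ x₃ : ℂ} (hq : ‖q‖ < 1) (h₃ : ∀ j : ℕ, x₃ * q ^ j ≠ 1) :
    Tendsto (fun n => qPoch x₁ q n * qPoch x₂ q n / (qPoch q q (n - 1) * qPoch x₃ q n)) atTop
      (𝓝 (qPochInf x₁ q * qPochInf x₂ q / (qPochInf q q * qPochInf x₃ q))) :=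
  ((tendsto_qPoch hq x₁).mul (tendsto_qPoch hq x₂)).div
    (((tendsto_qPoch hq q).comp (tendsto_sub_atTop_nat 1)).mul (tendsto_qPoch hq x₃))
    (mul_ne_zero (qPochInf_ne_zero hq (self_mul_pow_ne_one hq)) (qPochInf_ne_zero hq h₃))

theorem tendsto_one_sub_mul_pow {q : ℂ} (hq : ‖q‖ < 1) (c : ℂ) :
    Tendsto (fun j : ℕ => (1 - c * q ^ j)⁻¹) atTop (𝓝 1) := by
  have h : Tendsto (fun j : ℕ => 1 - c * q ^ j) atTop (𝓝 1) := by
    simpa using tendsto_const_nhds.sub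
      ((tendsto_pow_atTop_nhds_zero_of_norm_lt_one hq).const_mul c)
  simpa using h.inv₀ one_ne_zero

theorem summable_norm_residueCoeffInf {q x₁ x₂ x₃ : ℂ} (hq : ‖q‖ < 1)
    (h₃' : ∀ j : ℕ, q / x₃ * q ^ j ≠ 1) (hx : ‖x₁ * x₂ / x₃‖ < 1) :
    Summable fun j => ‖residueCoeffInf q x₁ x₂ x₃ j‖ := by
  have h := (summable_norm_phiCoeff_mul_pow (A := q / x₁) (B := q / x₂) hq h₃' hx).mul_right
    ‖qPochInf x₁ q * qPochInf x₂ q / (qPochInf q q * qPochInf x₃ q)‖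
  refine h.congr fun j => ?_
  rw [← norm_mul, residueCoeffInf, mul_comm (phiCoeff _ _ _ _ _)]

/-- Tannery's theorem: the ratios of finite products and the factors 1/(1 − cq^j) are bounded
uniformly in N and j, and the rest is a convergent series of ratio x₁x₂/x₃. -/
theorem tendsto_sum_residueCoeff {q x₁ x₂ x₃ c : ℂ} (hq : ‖q‖ < 1)
    (h₃ : ∀ j : ℕ, x₃ * q ^ j ≠ 1) (h₃' : ∀ j : ℕ, q / x₃ * q ^ j ≠ 1)
    (hx : ‖x₁ * x₂ / x₃‖ < 1) :
    Tendsto (fun N => ∑ j ∈ Finset.range N, residueCoeff q x₁ x₂ x₃ N j / (1 - c * q ^ j)) atTop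
      (𝓝 (∑' j, residueCoeffInf q x₁ x₂ x₃ j / (1 - c * q ^ j))) := by
  have hlim := tendsto_residue_ratio (x₁ := x₁) (x₂ := x₂) hq h₃
  obtain ⟨M₁, hM₁0, hM₁⟩ := exists_norm_le_of_tendsto hlim
  obtain ⟨M₂, hM₂0, hM₂⟩ := exists_norm_le_of_tendsto (tendsto_one_sub_mul_pow hq c)
  have hs := summable_norm_phiCoeff_mul_pow (A := q / x₁) (B := q / x₂) hq h₃' hx
  have key := tendsto_tsum_of_dominated_convergence (𝓕 := atTop)
    (f := fun N j => if j < N then residueCoeff q x₁ x₂ x₃ N j / (1 - c * q ^ j) else 0)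
    (g := fun j => residueCoeffInf q x₁ x₂ x₃ j / (1 - c * q ^ j))
    (bound := fun j => ‖phiCoeff (q / x₁) (q / x₂) (q / x₃) q j * (x₁ * x₂ / x₃) ^ j‖ * (M₁ * M₂))
    (hs.mul_right _) (fun j => by
      have h1 : Tendsto (fun N => residueCoeff q x₁ x₂ x₃ N j / (1 - c * q ^ j)) atTop
          (𝓝 (residueCoeffInf q x₁ x₂ x₃ j / (1 - c * q ^ j))) :=
        ((hlim.comp (tendsto_sub_atTop_nat j)).const_mul _).div_const _
      refine h1.congr' ?_
      filter_upwards [eventually_gt_atTop j] with N hN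
      rw [if_pos hN])
    (Eventually.of_forall fun N j => by
      have hnn : 0 ≤ ‖phiCoeff (q / x₁) (q / x₂) (q / x₃) q j * (x₁ * x₂ / x₃) ^ j‖ * (M₁ * M₂) := by
        positivity
      split_ifs with hj
      · rw [residueCoeff, div_eq_mul_inv, norm_mul, norm_mul, mul_comm ((x₁ * x₂ / x₃) ^ j),
          mul_assoc]
        gcongr
        · exact hM₁ (N - j)
        · exact hM₂ j
      · simpa using hnn)
  refine key.congr fun N => ?_
  rw [tsum_eq_sum (s := Finset.range N) (fun j hj => if_neg (by simpa using hj))]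
  exact Finset.sum_congr rfl fun j hj => if_pos (Finset.mem_range.1 hj)

/-- The bound `hgb` does double duty as N → ∞: it kills the constant term and makes both residue
series converge. -/
theorem qPochInf_ratio_partialFraction {q g₁ g₂ b₁ b₂ y : ℂ} (hq0 : q ≠ 0) (hq : ‖q‖ < 1)
    (hg₁ : g₁ ≠ 0) (hg₂ : g₂ ≠ 0) (hb₁ : b₁ ≠ 0) (hb₂ : b₂ ≠ 0) (hy0 : y ≠ 0)
    (hgb : ‖g₁ * g₂ / (b₁ * b₂)‖ < 1) (hb : ∀ m : ℤ, b₂ / b₁ ≠ q ^ m)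
    (hy₁ : ∀ j : ℕ, b₁ * y * q ^ j ≠ 1) (hy₂ : ∀ j : ℕ, b₂ * y * q ^ j ≠ 1) :
    qPochInf (g₁ * y) q * qPochInf (g₂ * y) q / (qPochInf (b₁ * y) q * qPochInf (b₂ * y) q) =
      ∑' j, residueCoeffInf q (g₁ / b₁) (g₂ / b₁) (b₂ / b₁) j / (1 - b₁ * y * q ^ j) +
        ∑' j, residueCoeffInf q (g₁ / b₂) (g₂ / b₂) (b₁ / b₂) j / (1 - b₂ * y * q ^ j) := by
  have hL := tendsto_qPoch_div (A := g₁ * y) (B := g₂ * y) hq hy₂ hy₁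
  have e₁ : g₁ / b₁ * (g₂ / b₁) / (b₂ / b₁) = g₁ * g₂ / (b₁ * b₂) := by field_simp
  have e₂ : g₁ / b₂ * (g₂ / b₂) / (b₁ / b₂) = g₁ * g₂ / (b₁ * b₂) := by field_simp
  have n₁ : ∀ j : ℕ, b₂ / b₁ * q ^ j ≠ 1 := fun j h => hb (-j) (by
    rw [zpow_neg, zpow_natCast, eq_inv_of_mul_eq_one_left h])
  have n₁' : ∀ j : ℕ, q / (b₂ / b₁) * q ^ j ≠ 1 := fun j h => hb (j + 1 : ℕ) (by
    rw [zpow_natCast, pow_succ']; field_simp at h ⊢; exact h.symm)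
  have n₂ : ∀ j : ℕ, b₁ / b₂ * q ^ j ≠ 1 := fun j h => hb j (by
    rw [zpow_natCast]; field_simp at h ⊢; exact h.symm)
  have n₂' : ∀ j : ℕ, q / (b₁ / b₂) * q ^ j ≠ 1 := fun j h => hb (-(j + 1 : ℕ)) (by
    rw [zpow_neg, zpow_natCast]
    refine eq_inv_of_mul_eq_one_left ?_
    rw [pow_succ']; field_simp at h ⊢; exact h)
  have hR := (tendsto_pow_atTop_nhds_zero_of_norm_lt_one hgb).add
    ((tendsto_sum_residueCoeff (c := b₁ * y) hq n₁ n₁' (by rwa [e₁])).add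
      (tendsto_sum_residueCoeff (c := b₂ * y) hq n₂ n₂' (by rwa [e₂])))
  rw [zero_add] at hR
  refine tendsto_nhds_unique hL (hR.congr fun N => ?_)
  rw [qPoch_ratio_partialFraction hq0 (self_mul_pow_ne_one hq) hg₁ hg₂ hb₁ hb₂ hy0 hb hy₁ hy₂]

end PartialFractions

/-! ### Integration over the unit circle: limits, termwise integration, Cauchy's formula. -/

section TorusIntegral

theorem circleMap_zero_one_mem_sphere (θ : ℝ) :
    circleMap 0 1 θ ∈ Metric.sphere (0 : ℂ) 1 := circleMap_mem_sphere 0 zero_le_one θ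

theorem torusIntegral1_eq_intervalIntegral (f : ℂ → ℂ) :
    torusIntegral1 f =
      (2 * (Real.pi : ℂ))⁻¹ * ∫ θ in (0 : ℝ)..2 * Real.pi, f (circleMap 0 1 θ) := by
  have h : ∀ θ : ℝ, deriv (circleMap 0 1) θ • (f (circleMap 0 1 θ) / circleMap 0 1 θ) =
      Complex.I * f (circleMap 0 1 θ) := fun θ => by
    have := circleMap_ne_center (c := 0) (R := 1) (θ := θ) one_ne_zero
    rw [deriv_circleMap, smul_eq_mul, show circleMap 0 1 θ * Complex.I *
      (f (circleMap 0 1 θ) / circleMap 0 1 θ) = Complex.I * f (circleMap 0 1 θ) *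
      (circleMap 0 1 θ / circleMap 0 1 θ) by ring, div_self this, mul_one]
  rw [torusIntegral1, circleIntegral]
  simp only [h]
  rw [intervalIntegral.integral_const_mul]
  have := Real.pi_ne_zero
  field_simp

theorem continuous_comp_circleMap {f : ℂ → ℂ} (hf : ContinuousOn f (Metric.sphere 0 1)) :
    Continuous fun θ : ℝ => f (circleMap 0 1 θ) :=
  hf.comp_continuous (continuous_circleMap 0 1) circleMap_zero_one_mem_sphere

theorem torusIntegral1_congr {f g : ℂ → ℂ} (h : ∀ z ∈ Metric.sphere (0 : ℂ) 1, f z = g z) :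
    torusIntegral1 f = torusIntegral1 g := by
  simp only [torusIntegral1_eq_intervalIntegral, h _ (circleMap_zero_one_mem_sphere _)]

theorem torusIntegral1_add {f g : ℂ → ℂ} (hf : ContinuousOn f (Metric.sphere 0 1))
    (hg : ContinuousOn g (Metric.sphere 0 1)) :
    torusIntegral1 (fun z => f z + g z) = torusIntegral1 f + torusIntegral1 g := by
  simp only [torusIntegral1_eq_intervalIntegral]
  rw [intervalIntegral.integral_add ((continuous_comp_circleMap hf).intervalIntegrable _ _)
    ((continuous_comp_circleMap hg).intervalIntegrable _ _), mul_add]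

theorem torusIntegral1_comp_inv (f : ℂ → ℂ) :
    torusIntegral1 (fun z => f z⁻¹) = torusIntegral1 f := by
  have h : ∀ θ : ℝ, (circleMap 0 1 θ)⁻¹ = circleMap 0 1 (2 * Real.pi - θ) := fun θ => by
    have h2 := periodic_circleMap 0 1 (-θ)
    rw [sub_eq_neg_add, h2]
    simp [circleMap, ← Complex.exp_neg]
  simp only [torusIntegral1_eq_intervalIntegral, h]
  rw [intervalIntegral.integral_comp_sub_left fun θ => f (circleMap 0 1 θ)]
  simp

theorem norm_torusIntegral1_le {f : ℂ → ℂ} {M : ℝ}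
    (hM : ∀ z ∈ Metric.sphere (0 : ℂ) 1, ‖f z‖ ≤ M) : ‖torusIntegral1 f‖ ≤ M := by
  have h := intervalIntegral.norm_integral_le_of_norm_le_const (a := 0) (b := 2 * Real.pi)
    (f := fun θ => f (circleMap 0 1 θ)) fun θ _ => hM _ (circleMap_zero_one_mem_sphere θ)
  have hpi := Real.pi_pos
  rw [torusIntegral1_eq_intervalIntegral, norm_mul, norm_inv, norm_mul, Complex.norm_ofNat,
    Complex.norm_real, Real.norm_of_nonneg hpi.le]
  rw [sub_zero, abs_of_pos (by positivity)] at h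
  rw [inv_mul_le_iff₀ (by positivity), mul_comm (2 * Real.pi)]
  exact h

theorem hasSum_torusIntegral1 {F : ℕ → ℂ → ℂ} {f : ℂ → ℂ} {b : ℕ → ℝ}
    (hF : ∀ j, ContinuousOn (F j) (Metric.sphere 0 1)) (hb : Summable b)
    (hFb : ∀ j, ∀ z ∈ Metric.sphere (0 : ℂ) 1, ‖F j z‖ ≤ b j)
    (hsum : ∀ z ∈ Metric.sphere (0 : ℂ) 1, HasSum (fun j => F j z) (f z)) :
    HasSum (fun j => torusIntegral1 (F j)) (torusIntegral1 f) := by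
  simp only [torusIntegral1_eq_intervalIntegral]
  refine HasSum.mul_left _ ?_
  refine intervalIntegral.hasSum_integral_of_dominated_convergence (fun j _ => b j)
    (fun j => (continuous_comp_circleMap (hF j)).aestronglyMeasurable)
    (fun j => Eventually.of_forall fun θ _ => hFb j _ (circleMap_zero_one_mem_sphere θ))
    (Eventually.of_forall fun _ _ => hb) intervalIntegrable_const
    (Eventually.of_forall fun θ _ => hsum _ (circleMap_zero_one_mem_sphere θ))

theorem tendsto_torusIntegral1 {X : Type*} {l : Filter X} [l.IsCountablyGenerated]
    {F : X → ℂ → ℂ} {f : ℂ → ℂ} {M : ℝ}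
    (hF : ∀ᶠ x in l, ContinuousOn (F x) (Metric.sphere 0 1))
    (hM : ∀ᶠ x in l, ∀ z ∈ Metric.sphere (0 : ℂ) 1, ‖F x z‖ ≤ M)
    (hlim : ∀ z ∈ Metric.sphere (0 : ℂ) 1, Tendsto (fun x => F x z) l (𝓝 (f z))) :
    Tendsto (fun x => torusIntegral1 (F x)) l (𝓝 (torusIntegral1 f)) := by
  simp only [torusIntegral1_eq_intervalIntegral]
  refine Tendsto.const_mul _ ?_
  refine intervalIntegral.tendsto_integral_filter_of_dominated_convergence (fun _ => M)
    (hF.mono fun x hx => (continuous_comp_circleMap hx).aestronglyMeasurable)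
    (hM.mono fun x hx => Eventually.of_forall fun θ _ => hx _ (circleMap_zero_one_mem_sphere θ))
    intervalIntegrable_const
    (Eventually.of_forall fun θ _ => hlim _ (circleMap_zero_one_mem_sphere θ))

/-- Since (1 − c/z)⁻¹ dz/z = dz/(z − c), this is Cauchy's integral formula. -/
theorem torusIntegral1_cauchy {g : ℂ → ℂ} (hg : DifferentiableOn ℂ g (Metric.closedBall 0 1))
    {c : ℂ} (hc : ‖c‖ < 1) (R : ℂ) :
    torusIntegral1 (fun z => g z * (R / (1 - c * z⁻¹))) = R * g c := by
  have h := (DifferentiableOn.diffContOnCl (f := fun z => R * g z) (s := Metric.ball (0 : ℂ) 1)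
    (by rw [closure_ball _ one_ne_zero]; exact hg.const_mul R)).circleIntegral_sub_inv_smul
    (w := c) (by simpa using hc)
  have e : ∮ z in C(0, 1), g z * (R / (1 - c * z⁻¹)) / z =
      ∮ z in C(0, 1), (z - c)⁻¹ • (R * g z) := by
    refine circleIntegral.integral_congr zero_le_one fun z hz => ?_
    have hz0 : z ≠ 0 := by rintro rfl; simp at hz
    have : z - c ≠ 0 := sub_ne_zero.2 fun h => by
      rw [h] at hz; simp at hz; exact hc.ne hz
    have h2 : 1 - c * z⁻¹ = (z - c) / z := by field_simp
    simp only [h2, smul_eq_mul]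
    field_simp
  rw [torusIntegral1, e, h, smul_eq_mul, ← mul_assoc, inv_mul_cancel₀ Complex.two_pi_I_ne_zero,
    one_mul]

theorem one_sub_norm_le_norm_one_sub {q c z : ℂ} (hq : ‖q‖ < 1)
    (hz : z ∈ Metric.sphere (0 : ℂ) 1) (j : ℕ) : 1 - ‖c‖ ≤ ‖1 - c * q ^ j * z⁻¹‖ := by
  have hz1 : ‖z‖ = 1 := by simpa using hz
  have h1 : ‖c * q ^ j * z⁻¹‖ ≤ ‖c‖ := by
    rw [norm_mul, norm_mul, norm_pow, norm_inv, hz1, inv_one, mul_one]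
    exact mul_le_of_le_one_right (norm_nonneg _) (pow_le_one₀ (norm_nonneg _) hq.le)
  have h2 := norm_sub_norm_le (1 : ℂ) (c * q ^ j * z⁻¹)
  rw [norm_one] at h2
  linarith

/-- On the circle |1 − cq^j/z| ≥ 1 − |c|, so the series is dominated by a multiple of the residue
norms and may be integrated termwise. -/
theorem hasSum_torusIntegral1_partialFraction {q c₁ c₂ : ℂ} {g : ℂ → ℂ} {R₁ R₂ : ℕ → ℂ}
    (hq : ‖q‖ < 1) (hg : DifferentiableOn ℂ g (Metric.closedBall 0 1))
    (hc₁ : ‖c₁‖ < 1) (hc₂ : ‖c₂‖ < 1)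
    (hR₁ : Summable fun j => ‖R₁ j‖) (hR₂ : Summable fun j => ‖R₂ j‖) :
    HasSum (fun j => R₁ j * g (c₁ * q ^ j) + R₂ j * g (c₂ * q ^ j))
      (torusIntegral1 fun z => g z * (∑' j, R₁ j / (1 - c₁ * q ^ j * z⁻¹) +
        ∑' j, R₂ j / (1 - c₂ * q ^ j * z⁻¹))) := by
  have hgs : ContinuousOn g (Metric.sphere 0 1) :=
    hg.continuousOn.mono Metric.sphere_subset_closedBall
  obtain ⟨M, hM⟩ := (isCompact_sphere (0 : ℂ) 1).exists_bound_of_continuousOn hgs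
  have hM0 : 0 ≤ M := (norm_nonneg _).trans (hM 1 (by simp))
  have hcq : ∀ c : ℂ, ‖c‖ < 1 → ∀ j : ℕ, ‖c * q ^ j‖ < 1 := fun c hc j => by
    rw [norm_mul, norm_pow]
    have := pow_le_one₀ (norm_nonneg q) hq.le (n := j)
    nlinarith [norm_nonneg c]
  have hne : ∀ c : ℂ, ‖c‖ < 1 → ∀ j : ℕ, ∀ z ∈ Metric.sphere (0 : ℂ) 1,
      1 - c * q ^ j * z⁻¹ ≠ 0 := fun c hc j z hz h => by
    have := one_sub_norm_le_norm_one_sub (c := c) hq hz j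
    rw [h, norm_zero] at this
    linarith
  have hcont : ∀ (c : ℂ) (_ : ‖c‖ < 1) (R : ℕ → ℂ) (j : ℕ),
      ContinuousOn (fun z => g z * (R j / (1 - c * q ^ j * z⁻¹))) (Metric.sphere 0 1) := by
    intro c hc R j
    refine hgs.mul (continuousOn_const.div (continuousOn_const.sub (continuousOn_const.mul
      (continuousOn_inv₀.mono fun z hz => ?_))) (hne c hc j))
    rintro rfl
    simp at hz
  have hbd : ∀ (c : ℂ) (_ : ‖c‖ < 1) (R : ℕ → ℂ) (j : ℕ), ∀ z ∈ Metric.sphere (0 : ℂ) 1,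
      ‖R j / (1 - c * q ^ j * z⁻¹)‖ ≤ ‖R j‖ * (1 - ‖c‖)⁻¹ := by
    intro c hc R j z hz
    rw [norm_div, div_eq_mul_inv]
    have h1 : 0 < 1 - ‖c‖ := by linarith
    gcongr
    exact one_sub_norm_le_norm_one_sub hq hz j
  have hcauchy : ∀ j, torusIntegral1 (fun z => g z * (R₁ j / (1 - c₁ * q ^ j * z⁻¹)) +
      g z * (R₂ j / (1 - c₂ * q ^ j * z⁻¹))) = R₁ j * g (c₁ * q ^ j) + R₂ j * g (c₂ * q ^ j) := by
    intro j
    rw [torusIntegral1_add (hcont c₁ hc₁ R₁ j) (hcont c₂ hc₂ R₂ j),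
      torusIntegral1_cauchy hg (hcq c₁ hc₁ j), torusIntegral1_cauchy hg (hcq c₂ hc₂ j)]
  simp only [← hcauchy]
  refine hasSum_torusIntegral1
    (b := fun j => M * (‖R₁ j‖ * (1 - ‖c₁‖)⁻¹) + M * (‖R₂ j‖ * (1 - ‖c₂‖)⁻¹))
    (fun j => (hcont c₁ hc₁ R₁ j).add (hcont c₂ hc₂ R₂ j))
    (((hR₁.mul_right _).mul_left _).add ((hR₂.mul_right _).mul_left _))
    (fun j z hz => (norm_add_le _ _).trans ?_) (fun z hz => ?_)
  · rw [norm_mul, norm_mul]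
    gcongr
    · exact hM z hz
    · exact hbd c₁ hc₁ R₁ j z hz
    · exact hM z hz
    · exact hbd c₂ hc₂ R₂ j z hz
  · have hs : ∀ (c : ℂ) (_ : ‖c‖ < 1) (R : ℕ → ℂ) (_ : Summable fun j => ‖R j‖),
        Summable fun j => R j / (1 - c * q ^ j * z⁻¹) := fun c hc R hR =>
      Summable.of_norm_bounded (hR.mul_right _) fun j => hbd c hc R j z hz
    rw [mul_add]
    exact ((hs c₁ hc₁ R₁ hR₁).hasSum.mul_left _).add ((hs c₂ hc₂ R₂ hR₂).hasSum.mul_left _)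

end TorusIntegral

/-! ### Regrouping a sum over fluxes and poles into a product of two series. -/

section Factorization

/-- The bijection `(k, j) ↦ (j + max k 0, j + max (-k) 0)`. -/
def intProdNatEquiv : ℤ × ℕ ≃ ℕ × ℕ where
  toFun p := (p.2 + p.1.toNat, p.2 + (-p.1).toNat)
  invFun p := ((p.1 : ℤ) - p.2, min p.1 p.2)
  left_inv p := by ext <;> grind
  right_inv p := by ext <;> grind

/-- The double series of the product is summed along the diagonals m − n = k. With j = min(m, n),
the monomial (aw)^m (a/w)^n is a^{2j+|k|} w^k, and {m, n} = {j, j + |k|} for either sign of k. -/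
theorem hasSum_int_factorization {T : ℕ → ℂ} {a w : ℂ} (hw : w ≠ 0)
    (h₁ : Summable fun n => ‖T n * (a * w) ^ n‖) (h₂ : Summable fun n => ‖T n * (a * w⁻¹) ^ n‖) :
    HasSum (fun k : ℤ => a ^ k.natAbs * w ^ k *
        ∑' j : ℕ, (a ^ 2) ^ j * T j * T (j + k.natAbs))
      ((∑' n, T n * (a * w) ^ n) * ∑' n, T n * (a * w⁻¹) ^ n) := by
  have hs := summable_mul_of_summable_norm h₁ h₂
  have hp : HasSum (fun p : ℕ × ℕ => T p.1 * (a * w) ^ p.1 * (T p.2 * (a * w⁻¹) ^ p.2))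
      ((∑' n, T n * (a * w) ^ n) * ∑' n, T n * (a * w⁻¹) ^ n) := by
    rw [h₁.of_norm.tsum_mul_tsum h₂.of_norm hs]
    exact hs.hasSum
  rw [← intProdNatEquiv.hasSum_iff] at hp
  have he : ∀ k : ℤ, ∀ j : ℕ,
      ((fun p : ℕ × ℕ => T p.1 * (a * w) ^ p.1 * (T p.2 * (a * w⁻¹) ^ p.2)) ∘ intProdNatEquiv)
        (k, j) = a ^ k.natAbs * w ^ k * ((a ^ 2) ^ j * T j * T (j + k.natAbs)) := by
    intro k j
    simp only [Function.comp, intProdNatEquiv, Equiv.coe_fn_mk]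
    obtain ⟨n, rfl | rfl⟩ := k.eq_nat_or_neg
    · simp only [Int.toNat_natCast, Int.toNat_neg_natCast, Int.natAbs_natCast, zpow_natCast,
        add_zero, mul_pow, pow_add, inv_pow]
      have := pow_ne_zero j hw
      field_simp
      ring
    · simp only [Int.toNat_natCast, Int.toNat_neg_natCast, Int.natAbs_natCast, zpow_natCast,
        Int.natAbs_neg, neg_neg, zpow_neg, add_zero, mul_pow, pow_add, inv_pow]
      have := pow_ne_zero j hw
      field_simp
      ring
  refine hp.prod_fiberwise fun k => ?_
  have hf := hp.summable.prod_factor k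
  simp only [he] at hf ⊢
  rw [← tsum_mul_left]
  exact hf.hasSum

end Factorization

/-! ### Residue evaluation of the electric index. -/

section ElectricIndex

/-- The factor of the electric integrand that depends on `x = q^{|k|/2} z` only; the other factor is
obtained by exchanging `u` and `v`. -/
noncomputable def chiralFactor (q r s u v x : ℂ) : ℂ :=
  qPochInf (s * r * v * x) q * qPochInf (s * r * v⁻¹ * x) q /
    (qPochInf (s⁻¹ * r * u * x) q * qPochInf (s⁻¹ * r * u⁻¹ * x) q)

theorem electricIntegrand_eq (q r s u v : ℂ) (k : ℤ) (z : ℂ) :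
    electricIntegrand q r s u v k z = chiralFactor q r s u v (r ^ k.natAbs * z) *
      chiralFactor q r s v u (r ^ k.natAbs * z⁻¹) := by
  have e : ∀ c d y : ℂ, c * r * d * (r ^ k.natAbs * y) = c * r ^ (1 + k.natAbs) * d * y :=
    fun c d y => by rw [pow_add, pow_one]; ring
  simp only [electricIntegrand, chiralFactor, e, div_mul_div_comm]
  congr 1 <;> ring

theorem chiralFactor_inv_right (q r s u v x : ℂ) :
    chiralFactor q r s u v⁻¹ x = chiralFactor q r s u v x := by
  simp only [chiralFactor, inv_inv, mul_comm (qPochInf (s * r * v * x) q)]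

/-- The coefficients of the `₂φ₁` series in the electric index. -/
noncomputable def electricCoeff (q a u v : ℂ) (n : ℕ) : ℂ :=
  phiCoeff (q * u * v / a) (q * v / (a * u)) (q * v ^ 2) q n

/-- The prefactor of the products of `₂φ₁` series in the electric index. -/
noncomputable def electricConst (q a u v : ℂ) : ℂ :=
  (qPochInf (q * v ^ 2) q * qPochInf (a * u / v) q * qPochInf (a / (u * v)) q) /
    (qPochInf (1 / v ^ 2) q * qPochInf (q * v / (a * u)) q * qPochInf (q * u * v / a) q)

theorem electricTerm_eq (q a u v w : ℂ) :
    electricTerm q a u v w = electricConst q a u v *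
      ((∑' n, electricCoeff q a u v n * (a * w) ^ n) *
        ∑' n, electricCoeff q a u v n * (a * w⁻¹) ^ n) := rfl

theorem qPochInf_mul_pow {q z : ℂ} (hq : ‖q‖ < 1) (hz : ∀ j : ℕ, z * q ^ j ≠ 1) (n : ℕ) :
    qPochInf (z * q ^ n) q = qPochInf z q / qPoch z q n := by
  rw [qPochInf_eq_mul hq z n, mul_div_cancel_left₀ _ (qPoch_ne_zero hz n)]

/-- All four symbols have the form (cq^m; q)_∞ = (c; q)_∞ / (c; q)_m, so the dependence on m is
exactly a ₂φ₁ coefficient. -/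
theorem chiralFactor_at_pole {q a r s u v : ℂ} (hq : ‖q‖ < 1) (ha : a ≠ 0) (hu : u ≠ 0)
    (hv : v ≠ 0) (hr : r ^ 2 = q) (hs : s ^ 2 = a)
    (hu₁ : ‖s⁻¹ * r * u‖ < 1) (hu₂ : ‖s⁻¹ * r * u⁻¹‖ < 1) (hv₁ : ‖s⁻¹ * r * v‖ < 1)
    (hC : ∀ j : ℕ, q * v ^ 2 * q ^ j ≠ 1) (m : ℕ) :
    chiralFactor q r s u v (s⁻¹ * r * v * q ^ m) =
      qPochInf (q * v ^ 2) q * qPochInf q q /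
        (qPochInf (q * u * v / a) q * qPochInf (q * v / (a * u)) q) * electricCoeff q a u v m := by
  have hs0 : s ≠ 0 := by rintro rfl; exact ha (by simp [← hs])
  have e₁ : s * r * v * (s⁻¹ * r * v * q ^ m) = q * v ^ 2 * q ^ m := by
    rw [← hr]; field_simp
  have e₂ : s * r * v⁻¹ * (s⁻¹ * r * v * q ^ m) = q * q ^ m := by
    nth_rw 2 [← hr]; field_simp
  have e₃ : s⁻¹ * r * u * (s⁻¹ * r * v) = q * u * v / a := by
    rw [← hr, ← hs]; field_simp
  have e₄ : s⁻¹ * r * u⁻¹ * (s⁻¹ * r * v) = q * v / (a * u) := by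
    rw [← hr, ← hs]; field_simp
  have n₃ : ‖q * u * v / a‖ < 1 := by
    rw [← e₃, norm_mul]; exact mul_lt_one_of_nonneg_of_lt_one_left (norm_nonneg _) hu₁ hv₁.le
  have n₄ : ‖q * v / (a * u)‖ < 1 := by
    rw [← e₄, norm_mul]; exact mul_lt_one_of_nonneg_of_lt_one_left (norm_nonneg _) hu₂ hv₁.le
  rw [chiralFactor, e₁, e₂, ← mul_assoc, e₃, ← mul_assoc, e₄, qPochInf_mul_pow hq hC,
    qPochInf_mul_pow hq (self_mul_pow_ne_one hq), qPochInf_mul_pow hq (mul_pow_ne_one hq n₃),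
    qPochInf_mul_pow hq (mul_pow_ne_one hq n₄), electricCoeff, phiCoeff]
  simp only [div_mul_div_comm, div_div_div_eq]
  congr 1
  ring

theorem residueCoeffInf_mul_chiralFactor {q a r s u v : ℂ} (hq0 : q ≠ 0) (hq : ‖q‖ < 1)
    (ha : a ≠ 0) (hu : u ≠ 0) (hv : v ≠ 0) (hr : r ^ 2 = q) (hs : s ^ 2 = a)
    (hu₁ : ‖s⁻¹ * r * u‖ < 1) (hu₂ : ‖s⁻¹ * r * u⁻¹‖ < 1) (hv₁ : ‖s⁻¹ * r * v‖ < 1)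
    (hC : ∀ j : ℕ, q * v ^ 2 * q ^ j ≠ 1) (n j : ℕ) :
    residueCoeffInf q (s * r * u / (s⁻¹ * r * v)) (s * r * u⁻¹ / (s⁻¹ * r * v))
        (s⁻¹ * r * v⁻¹ / (s⁻¹ * r * v)) j *
      chiralFactor q r s u v (r ^ n * (s⁻¹ * r * v * r ^ n * q ^ j)) =
    electricConst q a u v *
      ((a ^ 2) ^ j * electricCoeff q a u v j * electricCoeff q a u v (j + n)) := by
  have hs0 : s ≠ 0 := by rintro rfl; exact ha (by simp [← hs])
  have hr0 : r ≠ 0 := by rintro rfl; exact hq0 (by simp [← hr])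
  have e₁ : s * r * u / (s⁻¹ * r * v) = a * u / v := by rw [← hs]; field_simp
  have e₂ : s * r * u⁻¹ / (s⁻¹ * r * v) = a / (u * v) := by rw [← hs]; field_simp
  have e₃ : s⁻¹ * r * v⁻¹ / (s⁻¹ * r * v) = 1 / v ^ 2 := by field_simp
  have e₄ : r ^ n * (s⁻¹ * r * v * r ^ n * q ^ j) = s⁻¹ * r * v * q ^ (j + n) := by
    rw [pow_add, ← hr]; ring
  have e₅ : q / (a * u / v) = q * v / (a * u) := by field_simp
  have e₆ : q / (a / (u * v)) = q * u * v / a := by field_simp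
  have e₇ : q / (1 / v ^ 2) = q * v ^ 2 := by field_simp
  have e₈ : a * u / v * (a / (u * v)) / (1 / v ^ 2) = a ^ 2 := by field_simp
  have hqq := qPochInf_ne_zero hq (self_mul_pow_ne_one hq)
  have e₉ : phiCoeff (q * v / (a * u)) (q * u * v / a) (q * v ^ 2) q j =
      electricCoeff q a u v j := by
    rw [electricCoeff, phiCoeff, phiCoeff, mul_comm (qPoch (q * v / (a * u)) q j)]
  rw [e₁, e₂, e₃, e₄, chiralFactor_at_pole hq ha hu hv hr hs hu₁ hu₂ hv₁ hC, residueCoeffInf,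
    e₅, e₆, e₇, e₈, e₉, electricConst]
  field_simp

theorem differentiableAt_chiralFactor {q r s u x : ℂ} (hq : ‖q‖ < 1)
    (hu₁ : ‖s⁻¹ * r * u‖ < 1) (hu₂ : ‖s⁻¹ * r * u⁻¹‖ < 1) (v : ℂ) (hx : ‖x‖ ≤ 1) :
    DifferentiableAt ℂ (chiralFactor q r s u v) x := by
  have hd := differentiable_qPochInf hq
  have hn : ∀ c : ℂ, ‖c‖ < 1 → qPochInf (c * x) q ≠ 0 := fun c hc =>
    qPochInf_ne_zero_of_norm_lt hq (by
      rw [norm_mul]; exact mul_lt_one_of_nonneg_of_lt_one_left (norm_nonneg _) hc hx)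
  have h : ∀ c : ℂ, DifferentiableAt ℂ (fun x => qPochInf (c * x) q) x := fun c =>
    (hd (c * x)).comp x ((differentiableAt_id).const_mul c)
  exact ((h _).mul (h _)).div ((h _).mul (h _)) (mul_ne_zero (hn _ hu₁) (hn _ hu₂))

/-- Only the factor in 1/z is expanded; its poles s⁻¹ r v^{±1} r^{|k|} q^j lie inside the circle,
while the other factor is holomorphic on the closed disc. The two families are exchanged by v ↦ 1/v.
-/
theorem torusIntegral1_electricIntegrand {q a r s u v : ℂ} (hq0 : q ≠ 0) (hq : ‖q‖ < 1)
    (ha : a ≠ 0) (ha₁ : ‖a‖ < 1) (hu : u ≠ 0) (hv : v ≠ 0) (hr : r ^ 2 = q) (hs : s ^ 2 = a)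
    (hu₁ : ‖s⁻¹ * r * u‖ < 1) (hu₂ : ‖s⁻¹ * r * u⁻¹‖ < 1)
    (hv₁ : ‖s⁻¹ * r * v‖ < 1) (hv₂ : ‖s⁻¹ * r * v⁻¹‖ < 1)
    (hvq : ∀ m : ℤ, v ^ 2 ≠ q ^ m) (k : ℤ) :
    torusIntegral1 (electricIntegrand q r s u v k) =
      electricConst q a u v * ∑' j : ℕ,
          (a ^ 2) ^ j * electricCoeff q a u v j * electricCoeff q a u v (j + k.natAbs) +
      electricConst q a u v⁻¹ * ∑' j : ℕ,
          (a ^ 2) ^ j * electricCoeff q a u v⁻¹ j * electricCoeff q a u v⁻¹ (j + k.natAbs) := by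
  have hs0 : s ≠ 0 := by rintro rfl; exact ha (by simp [← hs])
  have hr0 : r ≠ 0 := by rintro rfl; exact hq0 (by simp [← hr])
  have hr1 : ‖r‖ ≤ 1 := by
    have : ‖r‖ ^ 2 < 1 := by rwa [← norm_pow, hr]
    nlinarith [norm_nonneg r]
  set n := k.natAbs with hn
  have hρ : ‖r ^ n‖ ≤ 1 := by rw [norm_pow]; exact pow_le_one₀ (norm_nonneg _) hr1
  have hρ0 : r ^ n ≠ 0 := pow_ne_zero _ hr0
  have hb : ∀ c : ℂ, ‖c‖ < 1 → ‖c * r ^ n‖ < 1 := fun c hc => by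
    rw [norm_mul]; exact mul_lt_one_of_nonneg_of_lt_one_left (norm_nonneg _) hc hρ
  have b₁0 : s⁻¹ * r * v ≠ 0 := by positivity
  have b₂0 : s⁻¹ * r * v⁻¹ ≠ 0 := by positivity
  have g₁0 : s * r * u ≠ 0 := by positivity
  have g₂0 : s * r * u⁻¹ ≠ 0 := by positivity
  have e21 : s⁻¹ * r * v⁻¹ / (s⁻¹ * r * v) = (v ^ 2)⁻¹ := by field_simp
  have e12 : s⁻¹ * r * v / (s⁻¹ * r * v⁻¹) = v ^ 2 := by field_simp
  have hgb : s * r * u * (s * r * u⁻¹) / (s⁻¹ * r * v * (s⁻¹ * r * v⁻¹)) = a ^ 2 := by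
    rw [← hs]; field_simp
  have hvq' : ∀ m : ℤ, (v ^ 2)⁻¹ ≠ q ^ m := fun m h => hvq (-m) (by rw [zpow_neg, ← h, inv_inv])
  have ha₂ : ‖a ^ 2‖ < 1 := by rw [norm_pow]; exact pow_lt_one₀ (norm_nonneg _) ha₁ two_ne_zero
  have hC₁ : ∀ j : ℕ, q * v ^ 2 * q ^ j ≠ 1 := fun j h => hvq (-(j + 1 : ℕ)) (by
    rw [zpow_neg, zpow_natCast]
    exact eq_inv_of_mul_eq_one_left (by rw [← h]; ring))
  have hC₂ : ∀ j : ℕ, q * v⁻¹ ^ 2 * q ^ j ≠ 1 := fun j h => hvq' (-(j + 1 : ℕ)) (by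
    rw [zpow_neg, zpow_natCast]
    exact eq_inv_of_mul_eq_one_left (by rw [← h, inv_pow]; ring))
  set R₁ := residueCoeffInf q (s * r * u / (s⁻¹ * r * v)) (s * r * u⁻¹ / (s⁻¹ * r * v))
    (s⁻¹ * r * v⁻¹ / (s⁻¹ * r * v)) with hR₁
  set R₂ := residueCoeffInf q (s * r * u / (s⁻¹ * r * v⁻¹)) (s * r * u⁻¹ / (s⁻¹ * r * v⁻¹))
    (s⁻¹ * r * v / (s⁻¹ * r * v⁻¹)) with hR₂
  have sR₁ : Summable fun j => ‖R₁ j‖ := summable_norm_residueCoeffInf hq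
    (fun j => by rw [e21, div_inv_eq_mul]; exact hC₁ j)
    (by rw [show s * r * u / (s⁻¹ * r * v) * (s * r * u⁻¹ / (s⁻¹ * r * v)) /
      (s⁻¹ * r * v⁻¹ / (s⁻¹ * r * v)) = a ^ 2 by rw [← hgb]; field_simp]; exact ha₂)
  have sR₂ : Summable fun j => ‖R₂ j‖ := summable_norm_residueCoeffInf hq
    (fun j => by rw [e12, div_eq_mul_inv, ← inv_pow]; exact hC₂ j)
    (by rw [show s * r * u / (s⁻¹ * r * v⁻¹) * (s * r * u⁻¹ / (s⁻¹ * r * v⁻¹)) /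
      (s⁻¹ * r * v / (s⁻¹ * r * v⁻¹)) = a ^ 2 by rw [← hgb]; field_simp]; exact ha₂)
  have hg : DifferentiableOn ℂ (fun z => chiralFactor q r s u v (r ^ n * z))
      (Metric.closedBall 0 1) := fun z hz => by
    have hz1 : ‖r ^ n * z‖ ≤ 1 := by
      rw [norm_mul]; exact mul_le_one₀ hρ (norm_nonneg _) (by simpa using hz)
    exact ((differentiableAt_chiralFactor hq hu₁ hu₂ v hz1).comp z
      (differentiableAt_id.const_mul _)).differentiableWithinAt
  have hsum := hasSum_torusIntegral1_partialFraction hq hg (hb _ hv₁) (hb _ hv₂) sR₁ sR₂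
  have hint : torusIntegral1 (electricIntegrand q r s u v k) =
      torusIntegral1 fun z => chiralFactor q r s u v (r ^ n * z) *
        (∑' j, R₁ j / (1 - s⁻¹ * r * v * r ^ n * q ^ j * z⁻¹) +
        ∑' j, R₂ j / (1 - s⁻¹ * r * v⁻¹ * r ^ n * q ^ j * z⁻¹)) := by
    refine torusIntegral1_congr fun z hz => ?_
    have hz1 : ‖z‖ = 1 := by simpa using hz
    have hz0 : z ≠ 0 := by rintro rfl; simp at hz1
    have hyn : ∀ c : ℂ, ‖c‖ < 1 → ∀ j : ℕ, c * (r ^ n * z⁻¹) * q ^ j ≠ 1 := fun c hc =>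
      mul_pow_ne_one hq (by
        rw [← mul_assoc, norm_mul, norm_inv, hz1, inv_one, mul_one]; exact hb c hc)
    rw [electricIntegrand_eq, ← hn]
    congr 1
    rw [chiralFactor, qPochInf_ratio_partialFraction hq0 hq g₁0 g₂0 b₁0 b₂0
      (mul_ne_zero hρ0 (inv_ne_zero hz0)) (by rw [hgb]; exact ha₂) (fun m => by rw [e21]; exact hvq' m)
      (hyn _ hv₁) (hyn _ hv₂)]
    congr 1 <;> refine tsum_congr fun j => ?_ <;> congr 2 <;> ring
  have h₁ : ∀ j, R₁ j * chiralFactor q r s u v (r ^ n * (s⁻¹ * r * v * r ^ n * q ^ j)) =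
      electricConst q a u v *
        ((a ^ 2) ^ j * electricCoeff q a u v j * electricCoeff q a u v (j + n)) :=
    residueCoeffInf_mul_chiralFactor hq0 hq ha hu hv hr hs hu₁ hu₂ hv₁ hC₁ n
  have h₂ : ∀ j, R₂ j * chiralFactor q r s u v (r ^ n * (s⁻¹ * r * v⁻¹ * r ^ n * q ^ j)) =
      electricConst q a u v⁻¹ *
        ((a ^ 2) ^ j * electricCoeff q a u v⁻¹ j * electricCoeff q a u v⁻¹ (j + n)) := fun j => by
    have := residueCoeffInf_mul_chiralFactor hq0 hq ha hu (inv_ne_zero hv) hr hs hu₁ hu₂ hv₂ hC₂ n j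
    rwa [chiralFactor_inv_right, inv_inv] at this
  simp only [h₁, h₂] at hsum
  have hsT : ∀ v' : ℂ, (∀ j : ℕ, q * v' ^ 2 * q ^ j ≠ 1) → Summable fun j =>
      (a ^ 2) ^ j * electricCoeff q a u v' j * electricCoeff q a u v' (j + n) := fun v' hC => by
    obtain ⟨M, -, hM⟩ := exists_norm_phiCoeff_le (A := q * u * v' / a) (B := q * v' / (a * u)) hq hC
    refine Summable.of_norm_bounded ((summable_norm_phiCoeff_mul_pow
      (A := q * u * v' / a) (B := q * v' / (a * u)) hq hC ha₂).mul_right M) fun j => ?_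
    rw [norm_mul, mul_comm ((a ^ 2) ^ j)]
    gcongr
    · exact le_rfl
    · exact hM _
  rw [hint, ← hsum.tsum_eq, ((hsT v hC₁).mul_left _).tsum_add ((hsT v⁻¹ hC₂).mul_left _),
    tsum_mul_left, tsum_mul_left]

theorem hasSum_electricSector {q a r s u v w : ℂ} (hq0 : q ≠ 0) (hq : ‖q‖ < 1)
    (ha : a ≠ 0) (hu : u ≠ 0) (hv : v ≠ 0) (hw : w ≠ 0) (hr : r ^ 2 = q) (hs : s ^ 2 = a)
    (hw₁ : ‖a * w‖ < 1) (hw₂ : ‖a * w⁻¹‖ < 1)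
    (hu₁ : ‖s⁻¹ * r * u‖ < 1) (hu₂ : ‖s⁻¹ * r * u⁻¹‖ < 1)
    (hv₁ : ‖s⁻¹ * r * v‖ < 1) (hv₂ : ‖s⁻¹ * r * v⁻¹‖ < 1)
    (hvq : ∀ m : ℤ, v ^ 2 ≠ q ^ m) :
    HasSum (electricSector q a r s u v w) (electricClosedForm q a u v w) := by
  -- The product of the two bounds on aw and a/w bounds |a|².
  have ha₁ : ‖a‖ < 1 := by
    have h : ‖a * w‖ * ‖a * w⁻¹‖ = ‖a‖ ^ 2 := by
      rw [← norm_mul, ← norm_pow]; congr 1; field_simp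
    nlinarith [norm_nonneg a, norm_nonneg (a * w), norm_nonneg (a * w⁻¹)]
  have hC₁ : ∀ j : ℕ, q * v ^ 2 * q ^ j ≠ 1 := fun j h => hvq (-(j + 1 : ℕ)) (by
    rw [zpow_neg, zpow_natCast]
    exact eq_inv_of_mul_eq_one_left (by rw [← h]; ring))
  have hC₂ : ∀ j : ℕ, q * v⁻¹ ^ 2 * q ^ j ≠ 1 := fun j h => hvq (j + 1 : ℕ) (by
    rw [zpow_natCast]; field_simp at h; rw [← h]; ring)
  have h₁ := (hasSum_int_factorization (T := electricCoeff q a u v) hw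
    (summable_norm_phiCoeff_mul_pow hq hC₁ hw₁)
    (summable_norm_phiCoeff_mul_pow hq hC₁ hw₂)).mul_left (electricConst q a u v)
  have h₂ := (hasSum_int_factorization (T := electricCoeff q a u v⁻¹) hw
    (summable_norm_phiCoeff_mul_pow hq hC₂ hw₁)
    (summable_norm_phiCoeff_mul_pow hq hC₂ hw₂)).mul_left (electricConst q a u v⁻¹)
  rw [electricClosedForm, electricTerm_eq, electricTerm_eq]
  refine (h₁.add h₂).congr_fun fun k => ?_
  rw [electricSector, torusIntegral1_electricIntegrand hq0 hq ha ha₁ hu hv hr hs hu₁ hu₂ hv₁ hv₂ hvq]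
  ring

end ElectricIndex

/-! ### Uniform bounds, absolute convergence and continuity in v. -/

section Continuity

theorem ContinuousAt.chiralFactor {X : Type*} [TopologicalSpace X] {q r s : ℂ} {f g h : X → ℂ}
    {p : X} (hq : ‖q‖ < 1) (hf : ContinuousAt f p) (hg : ContinuousAt g p) (hh : ContinuousAt h p)
    (hf0 : f p ≠ 0) (hg0 : g p ≠ 0) (hf₁ : ‖s⁻¹ * r * f p‖ < 1) (hf₂ : ‖s⁻¹ * r * (f p)⁻¹‖ < 1)
    (hh₁ : ‖h p‖ ≤ 1) : ContinuousAt (fun x => chiralFactor q r s (f x) (g x) (h x)) p := by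
  have hn : ∀ c : ℂ, ‖c‖ < 1 → qPochInf (c * h p) q ≠ 0 := fun c hc =>
    qPochInf_ne_zero_of_norm_lt hq (by
      rw [norm_mul]; exact mul_lt_one_of_nonneg_of_lt_one_left (norm_nonneg _) hc hh₁)
  have key : ∀ c : X → ℂ, ContinuousAt c p →
      ContinuousAt (fun x => qPochInf (s * r * c x * h x) q) p ∧
      ContinuousAt (fun x => qPochInf (s⁻¹ * r * c x * h x) q) p := fun c hc =>
    ⟨(continuous_qPochInf_of_norm_lt hq).continuousAt.comp ((hc.const_mul (s * r)).mul hh),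
      (continuous_qPochInf_of_norm_lt hq).continuousAt.comp ((hc.const_mul (s⁻¹ * r)).mul hh)⟩
  exact ((key g hg).1.mul (key _ (hg.inv₀ hg0)).1).div
    ((key f hf).2.mul (key _ (hf.inv₀ hf0)).2) (mul_ne_zero (hn _ hf₁) (hn _ hf₂))

/-- The flux enters only through t = r^{|k|}. Freeing t to range over the closed unit disc puts all
sectors into one compact family, hence the bounds uniform in k below. -/
theorem continuousAt_chiralFactor_mul {q r s u v t z : ℂ} (hq : ‖q‖ < 1) (hu : u ≠ 0)
    (hv : v ≠ 0) (hu₁ : ‖s⁻¹ * r * u‖ < 1) (hu₂ : ‖s⁻¹ * r * u⁻¹‖ < 1)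
    (hv₁ : ‖s⁻¹ * r * v‖ < 1) (hv₂ : ‖s⁻¹ * r * v⁻¹‖ < 1) (ht : ‖t‖ ≤ 1) (hz : ‖z‖ = 1) :
    ContinuousAt (fun p : ℂ × ℂ × ℂ => chiralFactor q r s u p.1 (p.2.1 * p.2.2) *
      chiralFactor q r s p.1 u (p.2.1 * p.2.2⁻¹)) (v, t, z) := by
  have hz0 : z ≠ 0 := by rintro rfl; simp at hz
  have c₁ : ContinuousAt (fun p : ℂ × ℂ × ℂ => p.1) (v, t, z) := continuousAt_fst
  have c₂ : ContinuousAt (fun p : ℂ × ℂ × ℂ => p.2.1) (v, t, z) := by fun_prop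
  have c₃ : ContinuousAt (fun p : ℂ × ℂ × ℂ => p.2.2) (v, t, z) := by fun_prop
  have c₀ : ContinuousAt (fun _ : ℂ × ℂ × ℂ => u) (v, t, z) := continuousAt_const
  exact (ContinuousAt.chiralFactor hq c₀ c₁ (c₂.mul c₃) hu hv hu₁ hu₂ (by simpa [hz] using ht)).mul
    (ContinuousAt.chiralFactor hq c₁ c₀ (c₂.mul (c₃.inv₀ hz0)) hv hu hv₁ hv₂
      (by simpa [hz] using ht))

theorem norm_pow_le_one_of_sq_eq {q r : ℂ} (hq : ‖q‖ < 1) (hr : r ^ 2 = q) (n : ℕ) :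
    ‖r ^ n‖ ≤ 1 := by
  have h : ‖r‖ ^ 2 < 1 := by rwa [← norm_pow, hr]
  rw [norm_pow]
  exact pow_le_one₀ (norm_nonneg _) (by nlinarith [norm_nonneg r])

theorem continuousOn_electricIntegrand {q r s u v : ℂ} (hq : ‖q‖ < 1) (hr : r ^ 2 = q)
    (hu : u ≠ 0) (hv : v ≠ 0) (hu₁ : ‖s⁻¹ * r * u‖ < 1) (hu₂ : ‖s⁻¹ * r * u⁻¹‖ < 1)
    (hv₁ : ‖s⁻¹ * r * v‖ < 1) (hv₂ : ‖s⁻¹ * r * v⁻¹‖ < 1) (k : ℤ) :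
    ContinuousOn (electricIntegrand q r s u v k) (Metric.sphere 0 1) := by
  intro z hz
  have h := continuousAt_chiralFactor_mul hq hu hv hu₁ hu₂ hv₁ hv₂
    (norm_pow_le_one_of_sq_eq hq hr k.natAbs) (by simpa using hz)
  have h' := ContinuousAt.comp (f := fun z : ℂ => (v, r ^ k.natAbs, z)) (x := z) h (by fun_prop)
  refine (h'.congr (Eventually.of_forall fun y => ?_)).continuousWithinAt
  exact (electricIntegrand_eq q r s u v k y).symm

theorem tendsto_electricIntegrand {q r s u v : ℂ} (hq : ‖q‖ < 1) (hr : r ^ 2 = q)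
    (hu : u ≠ 0) (hv : v ≠ 0) (hu₁ : ‖s⁻¹ * r * u‖ < 1) (hu₂ : ‖s⁻¹ * r * u⁻¹‖ < 1)
    (hv₁ : ‖s⁻¹ * r * v‖ < 1) (hv₂ : ‖s⁻¹ * r * v⁻¹‖ < 1) (k : ℤ) {z : ℂ}
    (hz : z ∈ Metric.sphere (0 : ℂ) 1) :
    Tendsto (fun v' => electricIntegrand q r s u v' k z) (𝓝 v)
      (𝓝 (electricIntegrand q r s u v k z)) := by
  have h := continuousAt_chiralFactor_mul hq hu hv hu₁ hu₂ hv₁ hv₂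
    (norm_pow_le_one_of_sq_eq hq hr k.natAbs) (by simpa using hz)
  have h' := ContinuousAt.comp (f := fun v' : ℂ => (v', r ^ k.natAbs, z)) (x := v) h (by fun_prop)
  have h'' : ContinuousAt (fun v' => electricIntegrand q r s u v' k z) v :=
    h'.congr (Eventually.of_forall fun y => (electricIntegrand_eq q r s u y k z).symm)
  exact h''

theorem eventually_flavour_conditions {r s v : ℂ} (hv : v ≠ 0)
    (hv₁ : ‖s⁻¹ * r * v‖ < 1) (hv₂ : ‖s⁻¹ * r * v⁻¹‖ < 1) :
    ∀ᶠ v' in 𝓝 v, v' ≠ 0 ∧ ‖s⁻¹ * r * v'‖ < 1 ∧ ‖s⁻¹ * r * v'⁻¹‖ < 1 := by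
  have hi : ContinuousAt (fun v' : ℂ => v'⁻¹) v := continuousAt_inv₀ hv
  have c₁ : ContinuousAt (fun v' : ℂ => ‖s⁻¹ * r * v'‖) v := by fun_prop
  have c₂ : ContinuousAt (fun v' : ℂ => ‖s⁻¹ * r * v'⁻¹‖) v := by fun_prop
  exact (eventually_ne_nhds hv).and
    ((c₁.eventually_lt_const hv₁).and (c₂.eventually_lt_const hv₂))

theorem exists_electricIntegrand_bound {q r s u v : ℂ} (hq : ‖q‖ < 1) (hr : r ^ 2 = q)
    (hu : u ≠ 0) (hv : v ≠ 0) (hu₁ : ‖s⁻¹ * r * u‖ < 1) (hu₂ : ‖s⁻¹ * r * u⁻¹‖ < 1)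
    (hv₁ : ‖s⁻¹ * r * v‖ < 1) (hv₂ : ‖s⁻¹ * r * v⁻¹‖ < 1) :
    ∃ M : ℝ, ∀ᶠ v' in 𝓝 v, ∀ k : ℤ, ∀ z ∈ Metric.sphere (0 : ℂ) 1,
      ‖electricIntegrand q r s u v' k z‖ ≤ M := by
  obtain ⟨K, hK, hKU, hKc⟩ :=
    LocallyCompactSpace.local_compact_nhds v _ (eventually_flavour_conditions hv hv₁ hv₂)
  have hcomp : IsCompact (K ×ˢ (Metric.closedBall (0 : ℂ) 1 ×ˢ Metric.sphere (0 : ℂ) 1)) :=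
    hKc.prod ((isCompact_closedBall 0 1).prod (isCompact_sphere 0 1))
  obtain ⟨M, hM⟩ := hcomp.exists_bound_of_continuousOn
    (f := fun p : ℂ × ℂ × ℂ => chiralFactor q r s u p.1 (p.2.1 * p.2.2) *
      chiralFactor q r s p.1 u (p.2.1 * p.2.2⁻¹)) (by
    rintro ⟨v', t, z⟩ ⟨hv', ht, hz⟩
    obtain ⟨h0, h1, h2⟩ := hKU hv'
    exact (continuousAt_chiralFactor_mul hq hu h0 hu₁ hu₂ h1 h2 (by simpa using ht)
      (by simpa using hz)).continuousWithinAt)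
  refine ⟨M, ?_⟩
  filter_upwards [hK] with v' hv' k z hz
  rw [electricIntegrand_eq]
  exact hM (v', r ^ k.natAbs, z) ⟨hv', by
    simpa using norm_pow_le_one_of_sq_eq hq hr k.natAbs, hz⟩

theorem summable_int_weight {a w : ℂ} (hw₁ : ‖a * w‖ < 1) (hw₂ : ‖a * w⁻¹‖ < 1) :
    Summable fun k : ℤ => ‖a ^ k.natAbs * w ^ k‖ := by
  refine Summable.of_nat_of_neg ?_ ?_
  · refine (summable_geometric_of_lt_one (norm_nonneg _) hw₁).congr fun n => ?_
    rw [Int.natAbs_natCast, zpow_natCast, ← mul_pow, norm_pow]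
  · refine (summable_geometric_of_lt_one (norm_nonneg _) hw₂).congr fun n => ?_
    rw [Int.natAbs_neg, Int.natAbs_natCast, zpow_neg, zpow_natCast, ← inv_pow, ← mul_pow, norm_pow]

theorem summable_electricSector {q a r s u v w : ℂ} (hq : ‖q‖ < 1) (hr : r ^ 2 = q)
    (hu : u ≠ 0) (hv : v ≠ 0) (hw₁ : ‖a * w‖ < 1) (hw₂ : ‖a * w⁻¹‖ < 1)
    (hu₁ : ‖s⁻¹ * r * u‖ < 1) (hu₂ : ‖s⁻¹ * r * u⁻¹‖ < 1)
    (hv₁ : ‖s⁻¹ * r * v‖ < 1) (hv₂ : ‖s⁻¹ * r * v⁻¹‖ < 1) :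
    Summable (electricSector q a r s u v w) := by
  obtain ⟨M, hM⟩ := exists_electricIntegrand_bound hq hr hu hv hu₁ hu₂ hv₁ hv₂
  refine Summable.of_norm_bounded ((summable_int_weight hw₁ hw₂).mul_right M) fun k => ?_
  rw [electricSector, norm_mul]
  gcongr
  exact norm_torusIntegral1_le (hM.self_of_nhds k)

/-- Dominated convergence, first in the integrals and then in the sum over k, with a bound uniform
in k and in v' near v. This argument does not involve the poles, so v² = 1 is allowed. -/
theorem continuousAt_electricIndex {q a r s u v w : ℂ} (hq : ‖q‖ < 1) (hr : r ^ 2 = q)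
    (hu : u ≠ 0) (hv : v ≠ 0) (hw₁ : ‖a * w‖ < 1) (hw₂ : ‖a * w⁻¹‖ < 1)
    (hu₁ : ‖s⁻¹ * r * u‖ < 1) (hu₂ : ‖s⁻¹ * r * u⁻¹‖ < 1)
    (hv₁ : ‖s⁻¹ * r * v‖ < 1) (hv₂ : ‖s⁻¹ * r * v⁻¹‖ < 1) :
    ContinuousAt (fun v' => electricIndex q a r s u v' w) v := by
  obtain ⟨M, hM⟩ := exists_electricIntegrand_bound hq hr hu hv hu₁ hu₂ hv₁ hv₂
  refine tendsto_tsum_of_dominated_convergence ((summable_int_weight hw₁ hw₂).mul_right M)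
    (fun k => ?_) ?_
  · refine Tendsto.const_mul _ (tendsto_torusIntegral1 (M := M) ?_ (hM.mono fun v' h => h k)
      fun z hz => tendsto_electricIntegrand hq hr hu hv hu₁ hu₂ hv₁ hv₂ k hz)
    filter_upwards [eventually_flavour_conditions hv hv₁ hv₂] with v' h
    exact continuousOn_electricIntegrand hq hr hu h.1 hu₁ hu₂ h.2.1 h.2.2 k
  · filter_upwards [hM] with v' h k
    rw [electricSector, norm_mul]
    gcongr
    exact norm_torusIntegral1_le (h k)

end Continuity

/-! ### The mirror side as the electric side at q/a, and equality of the closed forms. -/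

section Mirror

/-- A square root of q/a is r/s, so the substitution a ↦ q/a becomes s ↦ r/s. -/
theorem mirrorIntegrand_eq {q r s : ℂ} (hr : r ≠ 0) (u v : ℂ) (k : ℤ) (z : ℂ) :
    mirrorIntegrand q r s u v k z = electricIntegrand q r (r / s) u v k z⁻¹ := by
  have e₁ : r / s * r ^ (1 + k.natAbs) = s⁻¹ * r ^ (2 + k.natAbs) := by
    rw [pow_add, pow_add]; ring
  have e₂ : (r / s)⁻¹ * r ^ (1 + k.natAbs) = s * r ^ k.natAbs := by
    rw [pow_add, inv_div, pow_one]; field_simp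
  rw [mirrorIntegrand, electricIntegrand, e₁, e₂, inv_inv]
  congr 1 <;> ring

theorem mirrorSector_eq {q r s : ℂ} (hr : r ≠ 0) (a u v w : ℂ) :
    mirrorSector q a r s u v w = electricSector q (q / a) r (r / s) u v w := by
  funext k
  rw [mirrorSector, electricSector, ← torusIntegral1_comp_inv (electricIntegrand q r (r / s) u v k),
    funext (mirrorIntegrand_eq (q := q) (s := s) hr u v k)]

theorem mirrorIndex_eq {q r s : ℂ} (hr : r ≠ 0) (a u v w : ℂ) :
    mirrorIndex q a r s u v w =
      mirrorPrefactor q a u v w * electricIndex q (q / a) r (r / s) u v w := by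
  rw [mirrorIndex, mirrorSector_eq hr, electricIndex]

theorem mirrorTerm_eq {q a : ℂ} (hq0 : q ≠ 0) (u v w : ℂ) :
    mirrorTerm q a u v w = electricTerm q (q / a) u v w := by
  have e₁ : q / a * u / v = q * u / (a * v) := by rw [div_mul_eq_mul_div, div_div]
  have e₂ : q / a / (u * v) = q / (a * u * v) := by rw [div_div, mul_assoc]
  have e₃ : q * v / (q / a * u) = a * v / u := by
    rw [div_mul_eq_mul_div, div_div_eq_mul_div, mul_assoc, mul_div_mul_left _ _ hq0, mul_comm v]
  have e₄ : q * u * v / (q / a) = a * u * v := by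
    rw [div_div_eq_mul_div, mul_assoc, mul_assoc, mul_div_cancel_left₀ _ hq0]; ring
  have e₅ : ∀ x : ℂ, q / a * x = q * x / a := fun x => by rw [div_mul_eq_mul_div]
  rw [mirrorTerm, electricTerm, e₁, e₂, e₃, e₄, e₅, e₅]

theorem mirrorClosedForm_eq {q a : ℂ} (hq0 : q ≠ 0) (u v w : ℂ) :
    mirrorClosedForm q a u v w =
      mirrorPrefactor q a u v w * electricClosedForm q (q / a) u v w := by
  rw [mirrorClosedForm, electricClosedForm, mirrorTerm_eq hq0, mirrorTerm_eq hq0]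

theorem phi21_comm (A B C q Z : ℂ) : phi21 A B C q Z = phi21 B A C q Z := by
  simp only [phi21, mul_comm (qPoch A q _)]

theorem mirrorPrefactor_inv (q a u v w : ℂ) :
    mirrorPrefactor q a u v⁻¹ w = mirrorPrefactor q a u v w := by
  simp only [mirrorPrefactor, inv_inv]
  congr 2 <;> ring

/-- Bookkeeping for E(v) = P M(v): the xᵢ are the four symbols shared by P and M(v), which cancel,
and g/h, g'/h' are the factors from Heine's transformation. -/
theorem div_mul_div_cancel_four {x₁ x₂ x₃ x₄ : ℂ} (h₁ : x₁ ≠ 0) (h₂ : x₂ ≠ 0) (h₃ : x₃ ≠ 0)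
    (h₄ : x₄ ≠ 0) (V b c D m p g h g' h' F₁ F₂ : ℂ) :
    V * b * c / (D * m * p) * (g / h * F₁ * (g' / h' * F₂)) =
      g * g' / (h * h') * (x₁ * b * x₂ * c / (p * x₄ * m * x₃)) *
        (V * x₄ * x₃ / (D * x₂ * x₁) * (F₁ * F₂)) := by
  have key : x₁ * b * x₂ * c / (p * x₄ * m * x₃) * (V * x₄ * x₃ / (D * x₂ * x₁)) =
      V * b * c / (D * m * p) := by
    rw [div_mul_div_comm,
      show x₁ * b * x₂ * c * (V * x₄ * x₃) = (x₁ * x₂ * x₃ * x₄) * (V * b * c) by ring,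
      show p * x₄ * m * x₃ * (D * x₂ * x₁) = (x₁ * x₂ * x₃ * x₄) * (D * m * p) by ring,
      mul_div_mul_left _ _ (by positivity)]
  rw [← key]
  ring

theorem electricTerm_eq_mirrorPrefactor_mul_mirrorTerm {q a u v w : ℂ} (hq0 : q ≠ 0)
    (hq : ‖q‖ < 1) (ha : a ≠ 0) (hu : u ≠ 0) (hv : v ≠ 0)
    (hw₁ : ‖q‖ < ‖a * w‖ ∧ ‖a * w‖ < 1) (hw₂ : ‖q‖ < ‖a * w⁻¹‖ ∧ ‖a * w⁻¹‖ < 1)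
    (hvq : ∀ m : ℤ, v ^ 2 ≠ q ^ m) (h₁ : ∀ m : ℤ, a * u * v ≠ q ^ m)
    (h₂ : ∀ m : ℤ, a * u⁻¹ * v ≠ q ^ m) :
    electricTerm q a u v w = mirrorPrefactor q a u v w * mirrorTerm q a u v w := by
  have hw : w ≠ 0 := by rintro rfl; exact absurd hw₁.1 (by simp)
  have hC : ∀ j : ℕ, q * v ^ 2 * q ^ j ≠ 1 := fun j h => hvq (-(j + 1 : ℕ)) (by
    rw [zpow_neg, zpow_natCast]
    exact eq_inv_of_mul_eq_one_left (by rw [← h]; ring))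
  have hpow : ∀ x : ℂ, (∀ m : ℤ, x ≠ q ^ m) → ∀ j : ℕ, x * q ^ j ≠ 1 := fun x hx j h =>
    hx (-j) (by rw [zpow_neg, zpow_natCast]; exact eq_inv_of_mul_eq_one_left h)
  have hpow' : ∀ x : ℂ, x ≠ 0 → (∀ m : ℤ, x ≠ q ^ m) → ∀ j : ℕ, q / x * q ^ j ≠ 1 :=
    fun x hx0 hx j h => hx (j + 1 : ℕ) (by
      rw [zpow_natCast, pow_succ']; field_simp at h; exact h.symm)
  have n₁ := qPochInf_ne_zero hq (hpow _ h₁)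
  have n₂ := qPochInf_ne_zero hq (hpow _ h₂)
  have n₃ := qPochInf_ne_zero hq (hpow' _ (by positivity) h₁)
  have n₄ := qPochInf_ne_zero hq (hpow' _ (by positivity) h₂)
  rw [show q / (a * u * v) = q * u⁻¹ * v⁻¹ / a by field_simp] at n₃
  rw [show q / (a * u⁻¹ * v) = q * u * v⁻¹ / a by field_simp] at n₄
  have hZ : ∀ x : ℂ, x ≠ 0 → ‖q‖ < ‖a * x⁻¹‖ → ‖q * x / a‖ < 1 := fun x hx h => by
    have e : q * x / a * (a * x⁻¹) = q := by field_simp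
    have e' : ‖q * x / a‖ * ‖a * x⁻¹‖ = ‖q‖ := by rw [← norm_mul, e]
    have : 0 < ‖a * x⁻¹‖ := (norm_nonneg q).trans_lt h
    by_contra! hcon
    nlinarith
  have heine : ∀ x : ℂ, ‖a * x‖ < 1 → ‖q * x / a‖ < 1 →
      phi21 (q * u * v / a) (q * v / (a * u)) (q * v ^ 2) q (a * x) =
        qPochInf (q * x / a) q / qPochInf (a * x) q *
          phi21 (a * u * v) (a * v / u) (q * v ^ 2) q (q * x / a) := fun x hx hx' => by
    -- Here AB/C = q/a², which sends the argument ax to qx/a.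
    have e : q * u * v / a * (q * v / (a * u)) / (q * v ^ 2) * (a * x) = q * x / a := by field_simp
    have h := phi21_euler_transformation (A := q * u * v / a) (B := q * v / (a * u)) hq0 hq
      (by positivity) (by positivity) (by positivity) hC hx (by rwa [e])
    rw [e, show q * v ^ 2 / (q * u * v / a) = a * v / u by field_simp,
      show q * v ^ 2 / (q * v / (a * u)) = a * u * v by field_simp, phi21_comm (a * v / u)] at h
    exact h
  rw [electricTerm, mirrorTerm, mirrorPrefactor, heine w hw₁.2 (hZ w hw hw₂.1),
    heine w⁻¹ hw₂.2 (hZ w⁻¹ (inv_ne_zero hw) (by rw [inv_inv]; exact hw₁.1))]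
  rw [show a * u / v = a * u * v⁻¹ by ring, show a / (u * v) = a * u⁻¹ * v⁻¹ by field_simp,
    show q * v / (a * u) = q * u⁻¹ * v / a by field_simp,
    show q * u / (a * v) = q * u * v⁻¹ / a by field_simp,
    show q / (a * u * v) = q * u⁻¹ * v⁻¹ / a by field_simp,
    show a * v / u = a * u⁻¹ * v by ring]
  exact div_mul_div_cancel_four n₁ n₂ n₃ n₄ _ _ _ _ _ _ _ _ _ _ _ _

theorem electricClosedForm_eq_mirrorClosedForm {q a u v w : ℂ} (hq0 : q ≠ 0) (hq : ‖q‖ < 1)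
    (ha : a ≠ 0) (hu : u ≠ 0) (hv : v ≠ 0)
    (hw₁ : ‖q‖ < ‖a * w‖ ∧ ‖a * w‖ < 1) (hw₂ : ‖q‖ < ‖a * w⁻¹‖ ∧ ‖a * w⁻¹‖ < 1)
    (hvq : ∀ m : ℤ, v ^ 2 ≠ q ^ m)
    (h : ∀ m : ℤ, a * u * v ≠ q ^ m ∧ a * u * v⁻¹ ≠ q ^ m ∧
      a * u⁻¹ * v ≠ q ^ m ∧ a * u⁻¹ * v⁻¹ ≠ q ^ m) :
    electricClosedForm q a u v w = mirrorClosedForm q a u v w := by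
  have hvq' : ∀ m : ℤ, v⁻¹ ^ 2 ≠ q ^ m := fun m h => hvq (-m) (by
    rw [zpow_neg, ← h, inv_pow, inv_inv])
  rw [electricClosedForm, mirrorClosedForm, mul_add,
    electricTerm_eq_mirrorPrefactor_mul_mirrorTerm hq0 hq ha hu hv hw₁ hw₂ hvq
      (fun m => (h m).1) (fun m => (h m).2.2.1),
    electricTerm_eq_mirrorPrefactor_mul_mirrorTerm hq0 hq ha hu (inv_ne_zero hv) hw₁ hw₂ hvq'
      (fun m => (h m).2.1) (fun m => (h m).2.2.2), mirrorPrefactor_inv]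

end Mirror

/-! ### Consequences of the norm bounds, equality of the indices, and the limit v² → 1. -/

section Main

theorem norm_mul_lt_one_of_sq {q a r s x : ℂ} (hr : r ^ 2 = q) (hs : s ^ 2 = a) (ha : a ≠ 0)
    (hx : x ≠ 0) (h : ‖q‖ < ‖a * x⁻¹ ^ 2‖) : ‖s⁻¹ * r * x‖ < 1 := by
  have hs0 : s ≠ 0 := by rintro rfl; exact ha (by simp [← hs])
  have e : (s⁻¹ * r * x) ^ 2 * (a * x⁻¹ ^ 2) = q := by rw [← hr, ← hs]; field_simp
  have e' : ‖s⁻¹ * r * x‖ ^ 2 * ‖a * x⁻¹ ^ 2‖ = ‖q‖ := by rw [← norm_pow, ← norm_mul, e]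
  by_contra! hcon
  have h1 : 1 ≤ ‖s⁻¹ * r * x‖ ^ 2 := one_le_pow₀ hcon
  nlinarith [norm_nonneg (a * x⁻¹ ^ 2)]

theorem norm_mul_lt_one_of_sq' {a r s x : ℂ} (hs : s ^ 2 = a) (hr : r ≠ 0)
    (h : ‖a * x ^ 2‖ < 1) : ‖(r / s)⁻¹ * r * x‖ < 1 := by
  have e : (r / s)⁻¹ * r * x = s * x := by rw [inv_div]; field_simp
  rw [← hs, ← mul_pow, norm_pow] at h
  rw [e]
  exact (pow_lt_one_iff_of_nonneg (norm_nonneg _) two_ne_zero).1 h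

/-- If v² = q^m, the quotient of |av²| by |av⁻²| is |q|^{2m}. Both lie strictly between |q| and 1,
so −1 < 2m < 1, hence m = 0 and v² = 1. -/
theorem sq_ne_zpow {q a v : ℂ} (hq0 : q ≠ 0) (hq : ‖q‖ < 1) (hv : v ≠ 0) (hv2 : v ^ 2 ≠ 1)
    (h₁ : ‖q‖ < ‖a * v ^ 2‖ ∧ ‖a * v ^ 2‖ < 1) (h₂ : ‖q‖ < ‖a * v⁻¹ ^ 2‖ ∧ ‖a * v⁻¹ ^ 2‖ < 1)
    (m : ℤ) : v ^ 2 ≠ q ^ m := by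
  intro hm
  have e : ‖a * v⁻¹ ^ 2‖ * ‖q‖ ^ (2 * m) = ‖a * v ^ 2‖ := by
    rw [← norm_zpow, ← norm_mul, mul_comm 2 m, zpow_mul, ← hm]
    congr 1
    rw [show ((2 : ℤ)) = ((2 : ℕ) : ℤ) from rfl, zpow_natCast]
    field_simp
  have hqp : 0 < ‖q‖ := norm_pos_iff.2 hq0
  have hpos : 0 < ‖q‖ ^ (2 * m) := zpow_pos hqp _
  have l₁ : ‖q‖ ^ (1 : ℤ) < ‖q‖ ^ (2 * m) := by rw [zpow_one]; nlinarith
  have l₂ : ‖q‖ ^ (2 * m + 1) < ‖q‖ ^ (0 : ℤ) := by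
    rw [zpow_add₀ hqp.ne', zpow_one, zpow_zero]; nlinarith
  rw [zpow_lt_zpow_iff_right_of_lt_one₀ hqp hq] at l₁ l₂
  have : m = 0 := by omega
  rw [this, zpow_zero] at hm
  exact hv2 hm

theorem ne_zpow_of_norm {q x : ℂ} (hq0 : q ≠ 0) (hq : ‖q‖ < 1) (h₁ : ‖q‖ < ‖x‖) (h₂ : ‖x‖ < 1)
    (m : ℤ) : x ≠ q ^ m := by
  rintro rfl
  have hqp : 0 < ‖q‖ := norm_pos_iff.2 hq0
  have l₁ : ‖q‖ ^ (1 : ℤ) < ‖q‖ ^ m := by rwa [zpow_one, ← norm_zpow]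
  have l₂ : ‖q‖ ^ m < ‖q‖ ^ (0 : ℤ) := by rwa [zpow_zero, ← norm_zpow]
  rw [zpow_lt_zpow_iff_right_of_lt_one₀ hqp hq] at l₁ l₂
  omega

/-- |axy| is the geometric mean of |ax²| and |ay²|. -/
theorem norm_mul_mul_bounds {q a x y : ℂ} (hx : ‖q‖ < ‖a * x ^ 2‖ ∧ ‖a * x ^ 2‖ < 1)
    (hy : ‖q‖ < ‖a * y ^ 2‖ ∧ ‖a * y ^ 2‖ < 1) :
    ‖q‖ < ‖a * x * y‖ ∧ ‖a * x * y‖ < 1 := by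
  have e : ‖a * x * y‖ ^ 2 = ‖a * x ^ 2‖ * ‖a * y ^ 2‖ := by
    rw [← norm_pow, ← norm_mul]; congr 1; ring
  constructor
  · by_contra! hcon
    nlinarith [norm_nonneg (a * x * y), norm_nonneg q]
  · by_contra! hcon
    nlinarith [norm_nonneg (a * x ^ 2), norm_nonneg (a * y ^ 2)]

theorem norm_div_mul_lt_one {q a x : ℂ} (ha : a ≠ 0) (hx : x ≠ 0) (h : ‖q‖ < ‖a * x⁻¹‖) :
    ‖q / a * x‖ < 1 := by
  have e : q / a * x * (a * x⁻¹) = q := by field_simp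
  have e' : ‖q / a * x‖ * ‖a * x⁻¹‖ = ‖q‖ := by rw [← norm_mul, e]
  by_contra! hcon
  nlinarith [norm_nonneg (a * x⁻¹)]

theorem continuousAt_mirrorPrefactor {q a u v w : ℂ} (hq : ‖q‖ < 1) (hv : v ≠ 0)
    (h₁ : ‖q * u * v / a‖ < 1) (h₂ : ‖q * u * v⁻¹ / a‖ < 1)
    (h₃ : ‖q * u⁻¹ * v / a‖ < 1) (h₄ : ‖q * u⁻¹ * v⁻¹ / a‖ < 1) :
    ContinuousAt (fun v' => mirrorPrefactor q a u v' w) v := by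
  have hi : ContinuousAt (fun v' : ℂ => v'⁻¹) v := continuousAt_inv₀ hv
  have h : ∀ f : ℂ → ℂ, ContinuousAt f v → ContinuousAt (fun v' => qPochInf (f v') q) v :=
    fun f hf => (continuous_qPochInf_of_norm_lt hq).continuousAt.comp hf
  refine ContinuousAt.mul continuousAt_const (ContinuousAt.div ?_ ?_ ?_)
  · exact (((h _ (by fun_prop)).mul (h _ (by fun_prop))).mul (h _ (by fun_prop))).mul
      (h _ (by fun_prop))
  · exact (((h _ (by fun_prop)).mul (h _ (by fun_prop))).mul (h _ (by fun_prop))).mul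
      (h _ (by fun_prop))
  · exact mul_ne_zero (mul_ne_zero (mul_ne_zero (qPochInf_ne_zero_of_norm_lt hq h₁)
      (qPochInf_ne_zero_of_norm_lt hq h₂)) (qPochInf_ne_zero_of_norm_lt hq h₃))
      (qPochInf_ne_zero_of_norm_lt hq h₄)

theorem electricIndex_eq_mirrorIndex_of_sq_ne_one {q a r s u v w : ℂ} (hq0 : q ≠ 0)
    (hq : ‖q‖ < 1) (ha : a ≠ 0) (hu : u ≠ 0) (hv : v ≠ 0) (hw : w ≠ 0)
    (hw₁ : ‖q‖ < ‖a * w‖ ∧ ‖a * w‖ < 1) (hw₂ : ‖q‖ < ‖a * w⁻¹‖ ∧ ‖a * w⁻¹‖ < 1)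
    (hr : r ^ 2 = q) (hs : s ^ 2 = a)
    (hu₁ : ‖q‖ < ‖a * u ^ 2‖ ∧ ‖a * u ^ 2‖ < 1) (hu₂ : ‖q‖ < ‖a * u⁻¹ ^ 2‖ ∧ ‖a * u⁻¹ ^ 2‖ < 1)
    (hv₁ : ‖q‖ < ‖a * v ^ 2‖ ∧ ‖a * v ^ 2‖ < 1) (hv₂ : ‖q‖ < ‖a * v⁻¹ ^ 2‖ ∧ ‖a * v⁻¹ ^ 2‖ < 1)
    (hv2 : v ^ 2 ≠ 1) :
    electricIndex q a r s u v w = mirrorIndex q a r s u v w ∧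
      electricIndex q a r s u v w = electricClosedForm q a u v w ∧
      mirrorIndex q a r s u v w = mirrorClosedForm q a u v w := by
  have hr0 : r ≠ 0 := by rintro rfl; exact hq0 (by simp [← hr])
  have hvq := sq_ne_zpow hq0 hq hv hv2 hv₁ hv₂
  have hE : electricIndex q a r s u v w = electricClosedForm q a u v w :=
    (hasSum_electricSector hq0 hq ha hu hv hw hr hs hw₁.2 hw₂.2
      (norm_mul_lt_one_of_sq hr hs ha hu hu₂.1)
      (norm_mul_lt_one_of_sq hr hs ha (inv_ne_zero hu) (by rw [inv_inv]; exact hu₁.1))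
      (norm_mul_lt_one_of_sq hr hs ha hv hv₂.1)
      (norm_mul_lt_one_of_sq hr hs ha (inv_ne_zero hv) (by rw [inv_inv]; exact hv₁.1)) hvq).tsum_eq
  have hM : mirrorIndex q a r s u v w = mirrorClosedForm q a u v w := by
    rw [mirrorIndex_eq hr0, mirrorClosedForm_eq hq0]
    congr 1
    exact (hasSum_electricSector hq0 hq (div_ne_zero hq0 ha) hu hv hw hr (by rw [div_pow, hr, hs])
      (norm_div_mul_lt_one ha hw hw₂.1)
      (norm_div_mul_lt_one ha (inv_ne_zero hw) (by rw [inv_inv]; exact hw₁.1))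
      (norm_mul_lt_one_of_sq' hs hr0 hu₁.2) (norm_mul_lt_one_of_sq' hs hr0 hu₂.2)
      (norm_mul_lt_one_of_sq' hs hr0 hv₁.2) (norm_mul_lt_one_of_sq' hs hr0 hv₂.2) hvq).tsum_eq
  have hEM : electricClosedForm q a u v w = mirrorClosedForm q a u v w := by
    have n : ∀ x y : ℂ, ‖q‖ < ‖a * x ^ 2‖ ∧ ‖a * x ^ 2‖ < 1 →
        ‖q‖ < ‖a * y ^ 2‖ ∧ ‖a * y ^ 2‖ < 1 → ∀ m : ℤ, a * x * y ≠ q ^ m := fun x y hx hy =>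
      ne_zpow_of_norm hq0 hq (norm_mul_mul_bounds hx hy).1 (norm_mul_mul_bounds hx hy).2
    exact electricClosedForm_eq_mirrorClosedForm hq0 hq ha hu hv hw₁ hw₂ hvq fun m =>
      ⟨n u v hu₁ hv₁ m, n u v⁻¹ hu₁ hv₂ m, n u⁻¹ v hu₂ hv₁ m, n u⁻¹ v⁻¹ hu₂ hv₂ m⟩
  exact ⟨by rw [hE, hEM, hM], hE, hM⟩

theorem electricIndex_eq_mirrorIndex {q a r s u v w : ℂ} (hq0 : q ≠ 0)
    (hq : ‖q‖ < 1) (ha : a ≠ 0) (hu : u ≠ 0) (hv : v ≠ 0) (hw : w ≠ 0)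
    (hw₁ : ‖q‖ < ‖a * w‖ ∧ ‖a * w‖ < 1) (hw₂ : ‖q‖ < ‖a * w⁻¹‖ ∧ ‖a * w⁻¹‖ < 1)
    (hr : r ^ 2 = q) (hs : s ^ 2 = a)
    (hu₁ : ‖q‖ < ‖a * u ^ 2‖ ∧ ‖a * u ^ 2‖ < 1) (hu₂ : ‖q‖ < ‖a * u⁻¹ ^ 2‖ ∧ ‖a * u⁻¹ ^ 2‖ < 1)
    (hv₁ : ‖q‖ < ‖a * v ^ 2‖ ∧ ‖a * v ^ 2‖ < 1)
    (hv₂ : ‖q‖ < ‖a * v⁻¹ ^ 2‖ ∧ ‖a * v⁻¹ ^ 2‖ < 1) :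
    electricIndex q a r s u v w = mirrorIndex q a r s u v w := by
  by_cases hv2 : v ^ 2 ≠ 1
  · exact (electricIndex_eq_mirrorIndex_of_sq_ne_one hq0 hq ha hu hv hw hw₁ hw₂ hr hs hu₁ hu₂
      hv₁ hv₂ hv2).1
  -- The remaining case v² = 1, where the two families of poles collide, is reached as a limit of v'
  -- ≠ v.
  rw [not_ne_iff] at hv2
  have hr0 : r ≠ 0 := by rintro rfl; exact hq0 (by simp [← hr])
  have bu₁ := norm_mul_lt_one_of_sq hr hs ha hu hu₂.1
  have bu₂ := norm_mul_lt_one_of_sq hr hs ha (inv_ne_zero hu) (by rw [inv_inv]; exact hu₁.1)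
  have bv₁ := norm_mul_lt_one_of_sq hr hs ha hv hv₂.1
  have bv₂ := norm_mul_lt_one_of_sq hr hs ha (inv_ne_zero hv) (by rw [inv_inv]; exact hv₁.1)
  have hi : ContinuousAt (fun v' : ℂ => v'⁻¹) v := continuousAt_inv₀ hv
  have c₁ : ContinuousAt (fun v' : ℂ => ‖a * v' ^ 2‖) v := by fun_prop
  have c₂ : ContinuousAt (fun v' : ℂ => ‖a * v'⁻¹ ^ 2‖) v := by fun_prop
  -- The only solutions of v'² = 1 are v and −v, and −v ≠ v stays away from v.
  have hsq : ∀ᶠ v' in 𝓝[≠] v, v' ^ 2 ≠ 1 := by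
    have hne : v ≠ -v := fun h => hv (self_eq_neg.1 h)
    filter_upwards [eventually_nhdsWithin_of_eventually_nhds (eventually_ne_nhds hne),
      self_mem_nhdsWithin] with v' h₁ h₂ h
    rcases sq_eq_sq_iff_eq_or_eq_neg.1 (h.trans hv2.symm) with h | h
    · exact h₂ h
    · exact h₁ h
  have hev : ∀ᶠ v' in 𝓝[≠] v, electricIndex q a r s u v' w = mirrorIndex q a r s u v' w := by
    filter_upwards [hsq, eventually_nhdsWithin_of_eventually_nhds (eventually_ne_nhds hv),
      eventually_nhdsWithin_of_eventually_nhds (c₁.eventually_const_lt hv₁.1),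
      eventually_nhdsWithin_of_eventually_nhds (c₁.eventually_lt_const hv₁.2),
      eventually_nhdsWithin_of_eventually_nhds (c₂.eventually_const_lt hv₂.1),
      eventually_nhdsWithin_of_eventually_nhds (c₂.eventually_lt_const hv₂.2)]
      with v' h1 h2 h3 h4 h5 h6
    exact (electricIndex_eq_mirrorIndex_of_sq_ne_one hq0 hq ha hu h2 hw hw₁ hw₂ hr hs hu₁ hu₂
      ⟨h3, h4⟩ ⟨h5, h6⟩ h1).1
  have hcE : ContinuousAt (fun v' => electricIndex q a r s u v' w) v :=
    continuousAt_electricIndex hq hr hu hv hw₁.2 hw₂.2 bu₁ bu₂ bv₁ bv₂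
  have hcM : ContinuousAt (fun v' => mirrorIndex q a r s u v' w) v := by
    have hs0 : s ≠ 0 := by rintro rfl; exact ha (by simp [← hs])
    have hp : ∀ x y : ℂ, ‖s⁻¹ * r * x‖ < 1 → ‖s⁻¹ * r * y‖ < 1 → ‖q * x * y / a‖ < 1 :=
      fun x y hx hy => by
        rw [show q * x * y / a = s⁻¹ * r * x * (s⁻¹ * r * y) by rw [← hr, ← hs]; field_simp,
          norm_mul]
        exact mul_lt_one_of_nonneg_of_lt_one_left (norm_nonneg _) hx hy.le
    simp only [mirrorIndex_eq hr0]
    exact (continuousAt_mirrorPrefactor hq hv (hp _ _ bu₁ bv₁) (hp _ _ bu₁ bv₂) (hp _ _ bu₂ bv₁)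
      (hp _ _ bu₂ bv₂)).mul (continuousAt_electricIndex hq hr hu hv
      (norm_div_mul_lt_one ha hw hw₂.1)
      (norm_div_mul_lt_one ha (inv_ne_zero hw) (by rw [inv_inv]; exact hw₁.1))
      (norm_mul_lt_one_of_sq' hs hr0 hu₁.2) (norm_mul_lt_one_of_sq' hs hr0 hu₂.2)
      (norm_mul_lt_one_of_sq' hs hr0 hv₁.2) (norm_mul_lt_one_of_sq' hs hr0 hv₂.2))
  exact tendsto_nhds_unique_of_eventuallyEq (hcE.tendsto.mono_left nhdsWithin_le_nhds)
    (hcM.tendsto.mono_left nhdsWithin_le_nhds) hev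

end Main

theorem mainTheorem5 (q a u v w : ℂ)
    (hq0 : q ≠ 0) (hq1 : ‖q‖ < 1)
    (ha : a ≠ 0) (hu : u ≠ 0) (hv : v ≠ 0) (hw : w ≠ 0)
    (hw1 : ‖q‖ < ‖a * w‖ ∧ ‖a * w‖ < 1)
    (hw2 : ‖q‖ < ‖a * w⁻¹‖ ∧ ‖a * w⁻¹‖ < 1) :
    ((∀ m : ℤ, v ^ 2 ≠ q ^ m) →
      (∀ m : ℤ, a * u * v ≠ q ^ m ∧ a * u * v⁻¹ ≠ q ^ m ∧
        a * u⁻¹ * v ≠ q ^ m ∧ a * u⁻¹ * v⁻¹ ≠ q ^ m) →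
      electricClosedForm q a u v w = mirrorClosedForm q a u v w) ∧
    (∀ r s : ℂ, r ^ 2 = q → s ^ 2 = a →
      (‖q‖ < ‖a * u ^ 2‖ ∧ ‖a * u ^ 2‖ < 1) →
      (‖q‖ < ‖a * (u⁻¹) ^ 2‖ ∧ ‖a * (u⁻¹) ^ 2‖ < 1) →
      (‖q‖ < ‖a * v ^ 2‖ ∧ ‖a * v ^ 2‖ < 1) →
      (‖q‖ < ‖a * (v⁻¹) ^ 2‖ ∧ ‖a * (v⁻¹) ^ 2‖ < 1) →
      (∀ k : ℤ, ContinuousOn (electricIntegrand q r s u v k) (Metric.sphere 0 1)) ∧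
      (∀ k : ℤ, ContinuousOn (mirrorIntegrand q r s u v k) (Metric.sphere 0 1)) ∧
      Summable (electricSector q a r s u v w) ∧
      Summable (mirrorSector q a r s u v w) ∧
      electricIndex q a r s u v w = mirrorIndex q a r s u v w ∧
      (v ^ 2 ≠ 1 →
        electricIndex q a r s u v w = electricClosedForm q a u v w ∧
        mirrorIndex q a r s u v w = mirrorClosedForm q a u v w)) := by
  refine ⟨fun hvq h => electricClosedForm_eq_mirrorClosedForm hq0 hq1 ha hu hv hw1 hw2 hvq h, ?_⟩
  intro r s hr hs hu₁ hu₂ hv₁ hv₂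
  have hr0 : r ≠ 0 := by rintro rfl; exact hq0 (by simp [← hr])
  have bu₁ := norm_mul_lt_one_of_sq hr hs ha hu hu₂.1
  have bu₂ := norm_mul_lt_one_of_sq hr hs ha (inv_ne_zero hu) (by rw [inv_inv]; exact hu₁.1)
  have bv₁ := norm_mul_lt_one_of_sq hr hs ha hv hv₂.1
  have bv₂ := norm_mul_lt_one_of_sq hr hs ha (inv_ne_zero hv) (by rw [inv_inv]; exact hv₁.1)
  have mu₁ := norm_mul_lt_one_of_sq' hs hr0 hu₁.2
  have mu₂ := norm_mul_lt_one_of_sq' hs hr0 hu₂.2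
  have mv₁ := norm_mul_lt_one_of_sq' hs hr0 hv₁.2
  have mv₂ := norm_mul_lt_one_of_sq' hs hr0 hv₂.2
  refine ⟨continuousOn_electricIntegrand hq1 hr hu hv bu₁ bu₂ bv₁ bv₂, fun k => ?_,
    summable_electricSector hq1 hr hu hv hw1.2 hw2.2 bu₁ bu₂ bv₁ bv₂, ?_,
    electricIndex_eq_mirrorIndex hq0 hq1 ha hu hv hw hw1 hw2 hr hs hu₁ hu₂ hv₁ hv₂, fun hv2 =>
    (electricIndex_eq_mirrorIndex_of_sq_ne_one hq0 hq1 ha hu hv hw hw1 hw2 hr hs hu₁ hu₂ hv₁ hv₂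
      hv2).2⟩
  · have h := continuousOn_electricIntegrand hq1 hr hu hv mu₁ mu₂ mv₁ mv₂ k
    rw [funext (mirrorIntegrand_eq (q := q) (s := s) hr0 u v k)]
    refine h.comp (continuousOn_inv₀.mono fun z hz => ?_) fun z hz => by simpa using hz
    rintro rfl
    simp at hz
  · rw [mirrorSector_eq hr0]
    exact summable_electricSector hq1 hr hu hv (norm_div_mul_lt_one ha hw hw2.1)
      (norm_div_mul_lt_one ha (inv_ne_zero hw) (by rw [inv_inv]; exact hw1.1)) mu₁ mu₂ mv₁ mv₂
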